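/- **Setting.** For a set $X$ let $\Delta_f(X)$ be the set of probability distributions on $X$ with finite support (for finite $X$ this is the simplex $\Delta(X)$). Let $K,I,J,C,D$ be finite sets, $I,J$ nonempty, $g:K\times I\times J\to[0,1]$ and $q:K\times I\times J\to\Delta(K\times C\times D)$. Let $\pi$ be a finitely supported distribution on $K\times C'\times D'$, where $C',D'$ are arbitrary sets of initial signals. In the repeated game $\Gamma(\pi)$ a triple $(k_1,c_1,d_1)$ is drawn from $\pi$; at every stage $m\ge1$ player 1 observes $c_m$, player 2 observes $d_m$, they choose actions $(i_m,j_m)$, the stage payoff of player 1 (unobserved) is $g(k_m,i_m,j_m)$, and $(k_{m+1},c_{m+1},d_{m+1})$ is drawn from $q(k_m,i_m,j_m)$. Private histories are $h^I_m=(c_1,i_1,\dots,i_{m-1},c_m)$ and $h^{II}_m=(d_1,j_1,\dots,j_{m-1},d_m)$; behavior strategies $\sigma$ and $\tau$ map private histories to $\Delta(I)$ and $\Delta(J)$ respectively; $\mathbb P^\pi_{\sigma\tau}$ is the induced law. Put $\gamma_n(\pi,\sigma,\tau)=\mathbb E^\pi_{\sigma\tau}[\frac1n\sum_{m=1}^n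 g(k_m,i_m,j_m)]$, and for $n\ge1$, $m\ge0$ let $$v_{m,n}(\pi)=\sup_\sigma\inf_\tau\mathbb E^\pi_{\sigma\tau}\Big[\tfrac1n\sum_{t=m+1}^{m+n}g(k_t,i_t,j_t)\Big],\qquad v^*(\pi)=\inf_{n\ge1}\sup_{m\ge0}v_{m,n}(\pi).$$ A strategy $\sigma$ guarantees $w\in\mathbb R$ in $\Gamma_\infty(\pi)$ if there is $N$ such that $\gamma_n(\pi,\sigma,\tau)\ge w$ for all $n\ge N$ and all $\tau$. Player 2 can guarantee $v$ in $\Gamma_\infty(\pi)$ if for every $\varepsilon>0$ there are $\tau$ and $N$ such that $\gamma_n(\pi,\sigma,\tau)\le v+\varepsilon$ for all $n\ge N$ and all $\sigma$. **Beliefs.** For a finitely supported law of a triple $(k,c,d)$ let $x=\mathcal L(k\mid c)\in\Delta(K)$, $y=\mathcal L(x\mid d)\in\Delta_f(\Delta(K))$ and $\Phi=\mathcal L(y)$. Applied to $(k_n,h^I_n,h^{II}_n)$ under $\mathbb P^\pi_{\sigma\tau}$ this gives $x_n$, $y_n$ and $\eta_n=\mathcal L(y_n)$. Let $\Delta^*_f$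 be the set of $\pi\in\Delta_f(K\times\mathbb N\times\mathbb N)$ such that $\pi(c)\pi(k,c,d)=\pi(k,c)\pi(c,d)$ for all $k,c,d$, and such that $y_1$ is $\pi$-a.s. a function of $c_1$. A strategy $\sigma$ of player 1 is reduced (for $\pi$) if it depends on the initial signal $c_1$ only through $(x_1,y_1)$. **Assumptions.** For every $\pi\in\Delta^*_f$: (A1) $\mathcal L(k_n\mid h^I_n,h^{II}_n)=\mathcal L(k_n\mid h^I_n)$ $\mathbb P^\pi_{\sigma\tau}$-a.s., for all $n\ge1$ and all $\sigma,\tau$; (A2) for every reduced $\sigma$ and every $\tau$, $y_2$ is $\mathbb P^\pi_{\sigma\tau}$-a.s. a function of $h^I_2=(c_1,i_1,c_2)$; (A3) for every reduced $\sigma$, $\eta_2$ does not depend on $\tau$. **Canonical and auxiliary games.** For $z\in X:=\Delta_f(\Delta(K))$ let $\widehat\Gamma(z)$ be the repeated game in which $p$ is drawn from $z$ and $k_1$ from $p$, player 1 has initial signal $(p,z)$ and player 2 has initial signal $z$. Let $\mathcal G(z)$ be the stochastic game with perfect observation of past states and actions, with state space $X$ and initial state $z$, with action sets $A=\{a:\Delta(K)\to\Delta(I)\text{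 measurable}\}$ of player 1 and $B=\Delta(J)$ of player 2, stage payoff $G(z,a,b)=\sum_p z(p)\sum_{k,i,j}p(k)\,a(p)(i)\,b(j)\,g(k,i,j)$, and transition $\ell(z,a,b)=\Phi(Q(z,a,b))$, where $Q(z,a,b)$ is the law of $(k_2,(p,i_1,c_2),(j_1,d_2))$ in $\widehat\Gamma(z)$ when the players use $a$ and $b$ at the first stage. A Markov strategy $\widehat\sigma=(\widehat\sigma_n)_{n\ge1}$ of player 1 in $\mathcal G$ consists of maps $\widehat\sigma_n:X\to A$. It guarantees $w$ in $\mathcal G_\infty(z)$ if there is $N$ such that for all $n\ge N$ its expected average payoff over the first $n$ stages is at least $w$ against every strategy of player 2, where strategies of player 2 are maps from histories (past states and actions, and the current state) to $B$. **Theorem.** Assume (A1), (A2), (A3). 1. For every $z\in X$ and every Markov strategy $\widehat\sigma$ of player 1 in $\mathcal G_\infty(z)$ there is a strategy $\sigma$ of player 1 in $\widehat\Gamma_\infty(z)$ that is induced by $\widehat\sigma$, that is, for all $\tau$ and $n$, $\sigma(h^I_n)=\widehat\sigma_n(y_n)(x_n)$ a.s. in $\widehat\Gamma(z)$ under $(\sigma,\tau)$.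 Every such $\sigma$ guarantees the same amounts as $\widehat\sigma$: for every $w\in\mathbb R$, $\widehat\sigma$ guarantees $w$ in $\mathcal G_\infty(z)$ if and only if $\sigma$ guarantees $w$ in $\widehat\Gamma_\infty(z)$. 2. For every $\pi\in\Delta^*_f$, player 2 can guarantee $v^*(\pi)$ in $\Gamma_\infty(\pi)$. -/

import Mathlib

open Convexity

noncomputable section

namespace RepGame

/-! ### Finitely supported probability distributions -/

/-- `Δ_f(α)`, the set of probability distributions on `α` with finite support. For a finite type
`α` this is the simplex `Δ(α)` of all probability distributions on `α`. -/
abbrev FinDist (α : Type*) := StdSimplex ℝ α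

/-- The σ-algebra on `Δ_f(α)` generated by the evaluations `p ↦ p(a)`. For finite `α` it is the
Borel σ-algebra of the simplex `Δ(α) ⊆ ℝ^α`. -/
instance instMeasurableSpaceFinDist {α : Type*} : MeasurableSpace (FinDist α) :=
  MeasurableSpace.comap (fun p (a : α) => p.weights a) MeasurableSpace.pi

/-- The support of `μ`, i.e. the set of outcomes that have positive probability. -/
def supp {α : Type*} (μ : FinDist α) : Set α := {a | μ.weights a ≠ 0}

/-- The expectation of `f` under `μ`. -/
def expect {α : Type*} (μ : FinDist α) (f : α → ℝ) : ℝ := μ.weights.sum fun a r => r * f a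

/-- The mixture `∑ a, μ(a) κ(a)`: draw `a` according to `μ` and then draw according to `κ a`. -/
def mix {α β : Type*} (μ : FinDist α) (κ : α → FinDist β) : FinDist β := μ.iConvexComb κ

open Classical in
/-- The conditional law under `μ` of the random variable `f` given that `g = c`. It is meaningful
for `μ(g = c) > 0`; otherwise it is set to be the unconditional law of `f`. -/
def condLaw {α β γ : Type*} (μ : FinDist α) (f : α → β) (g : α → γ) (c : γ) : FinDist β :=
  if h : ∃ a ∈ {a | g a = c}, μ.weights a ≠ 0 then (μ.restrict {a | g a = c} h).map f
  else μ.map f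

/-! ### Beliefs

In this section `μ` is the joint law of a triple `(k, c, d)`: a state, the information `c` of
player 1 and the information `d` of player 2. -/

section Beliefs

variable {K S T : Type*}

/-- `Δ_f(Δ(K))`, the set of second order beliefs. -/
abbrev Belief2 (K : Type*) := FinDist (FinDist K)

/-- First order belief `x = L(k | c)` of player 1. -/
def belief1 (μ : FinDist (K × S × T)) (c : S) : FinDist K :=
  condLaw μ (fun ω => ω.1) (fun ω => ω.2.1) c

/-- Second order belief `y = L(x | d)` of player 2. -/
def belief2 (μ : FinDist (K × S × T)) (d : T) : Belief2 K :=
  condLaw μ (fun ω => belief1 μ ω.2.1) (fun ω => ω.2.2) d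

/-- `Φ(μ) = L(y) = L(L(L(k | c) | d))`, the law of the second order belief of player 2. -/
def Phi (μ : FinDist (K × S × T)) : FinDist (Belief2 K) := μ.map fun ω => belief2 μ ω.2.2

/-- Condition (A1a): `μ(c) μ(k,c,d) = μ(k,c) μ(c,d)`. -/
def A1a (μ : FinDist (K × S × T)) : Prop :=
  ∀ k c d, (μ.map fun ω => ω.2.1).weights c * μ.weights (k, c, d) =
    (μ.map fun ω => (ω.1, ω.2.1)).weights (k, c) * (μ.map fun ω => ω.2).weights (c, d)

/-- Condition (A2a): the second order belief of player 2 is a.s. a function of the information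
of player 1. -/
def A2a (μ : FinDist (K × S × T)) : Prop :=
  ∃ f : S → Belief2 K, ∀ ω ∈ supp μ, belief2 μ ω.2.2 = f ω.2.1

/-- The set `Δ*_f(K × ℕ × ℕ)`. -/
def DeltaStar (K : Type*) : Set (FinDist (K × ℕ × ℕ)) := {π | A1a π ∧ A2a π}

end Beliefs

/-! ### The repeated game -/

/-- A private history `(s₁, a₁, s₂, …, a_{n-1}, s_n)` of a player: an initial signal in `S`, and a
list of pairs (own action, next signal). **The most recent pair is the head of the list**, and
at stage `n` the list has length `n - 1`. -/
abbrev History (S A O : Type*) := S × List (A × O)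

/-- A behavior strategy of a player with initial signals in `S`, actions in `A`, and later
signals in `O`. -/
abbrev Strategy (S A O : Type*) := History S A O → FinDist A

/-- The data `(K, I, J, g, C, D, q)` of a repeated game (the initial distribution is a separate
argument below). -/
structure Game (K I J C D : Type*) where
  /-- stage payoff of player 1 -/
  g : K → I → J → ℝ
  g_mem : ∀ k i j, g k i j ∈ Set.Icc (0 : ℝ) 1
  /-- transition function -/
  q : K → I → J → FinDist (K × C × D)

variable {K I J C D S T : Type*}

/-- The law of `(k_n, h^I_n, h^II_n)` under `ℙ^π_{σ,τ}`, where `n = t + 1`. -/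
def stageLaw (G : Game K I J C D) (π : FinDist (K × S × T)) (σ : Strategy S I C)
    (τ : Strategy T J D) : ℕ → FinDist (K × History S I C × History T J D)
  | 0 => π.map fun ω => (ω.1, (ω.2.1, []), (ω.2.2, []))
  | t + 1 => mix (stageLaw G π σ τ t) fun ω =>
      mix (σ ω.2.1) fun i => mix (τ ω.2.2) fun j =>
        (G.q ω.1 i j).map fun r =>
          (r.1, (ω.2.1.1, (i, r.2.1) :: ω.2.1.2), (ω.2.2.1, (j, r.2.2) :: ω.2.2.2))

/-- The expected payoff `𝔼^π_{σ,τ}[g(k_n, i_n, j_n)]` at stage `n = t + 1`. -/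
def stagePayoff (G : Game K I J C D) (π : FinDist (K × S × T)) (σ : Strategy S I C)
    (τ : Strategy T J D) (t : ℕ) : ℝ :=
  expect (stageLaw G π σ τ t) fun ω =>
    expect (σ ω.2.1) fun i => expect (τ ω.2.2) fun j => G.g ω.1 i j

/-- The expected average payoff of the `n` stages `m + 1, …, m + n`. -/
def avgPayoff (G : Game K I J C D) (π : FinDist (K × S × T)) (σ : Strategy S I C)
    (τ : Strategy T J D) (m n : ℕ) : ℝ :=
  (∑ t ∈ Finset.range n, stagePayoff G π σ τ (m + t)) / n

/-- The value `v_{m,n}(π) = sup_σ inf_τ` of the game whose payoff is the expected average payoff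
of the stages `m + 1, …, m + n`. -/
def value (G : Game K I J C D) (π : FinDist (K × S × T)) (m n : ℕ) : ℝ :=
  ⨆ σ : Strategy S I C, ⨅ τ : Strategy T J D, avgPayoff G π σ τ m n

/-- `v*(π) = inf_{n ≥ 1} sup_{m ≥ 0} v_{m,n}(π)`. -/
def vStar (G : Game K I J C D) (π : FinDist (K × S × T)) : ℝ :=
  ⨅ n : ℕ+, ⨆ m : ℕ, value G π m n

/-- The strategy `σ` of player 1 guarantees the amount `w` in `Γ_∞(π)`. -/
def Guarantees (G : Game K I J C D) (π : FinDist (K × S × T)) (σ : Strategy S I C)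
    (w : ℝ) : Prop :=
  ∃ N : ℕ, ∀ n ≥ N, ∀ τ : Strategy T J D, w ≤ avgPayoff G π σ τ 0 n

/-- Player 2 can guarantee `v` in `Γ_∞(π)`. -/
def Player2CanGuarantee (G : Game K I J C D) (π : FinDist (K × S × T)) (v : ℝ) : Prop :=
  ∀ ε > 0, ∃ τ : Strategy T J D, ∃ N : ℕ, ∀ n ≥ N, ∀ σ : Strategy S I C,
    avgPayoff G π σ τ 0 n ≤ v + ε

/-! ### The assumptions of a more informed controller -/

/-- (A1): `L(k_n | h^I_n, h^II_n) = L(k_n | h^I_n)` a.s., at all stages and for all strategies. -/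
def A1 (G : Game K I J C D) : Prop :=
  ∀ π ∈ DeltaStar K, ∀ (σ : Strategy ℕ I C) (τ : Strategy ℕ J D) (t : ℕ),
    ∀ ω ∈ supp (stageLaw G π σ τ t),
      condLaw (stageLaw G π σ τ t) (fun ω => ω.1) (fun ω => ω.2) ω.2 =
        condLaw (stageLaw G π σ τ t) (fun ω => ω.1) (fun ω => ω.2.1) ω.2.1

/-- `σ` is a reduced strategy: it depends on the initial signal `c₁` (of positive probability)
only through `(x₁, y₁)`. -/
def IsReduced (π : FinDist (K × S × T)) (σ : Strategy S I C) : Prop :=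
  ∀ ω ∈ supp π, ∀ ω' ∈ supp π, belief1 π ω.2.1 = belief1 π ω'.2.1 →
    belief2 π ω.2.2 = belief2 π ω'.2.2 → ∀ l, σ (ω.2.1, l) = σ (ω'.2.1, l)

/-- (A2b): if player 1 uses a reduced strategy, then `y₂` is a.s. a function of
`h^I_2 = (c₁, i₁, c₂)`. -/
def A2b (G : Game K I J C D) : Prop :=
  ∀ π ∈ DeltaStar K, ∀ σ : Strategy ℕ I C, IsReduced π σ → ∀ τ : Strategy ℕ J D,
    ∃ f : History ℕ I C → Belief2 K, ∀ ω ∈ supp (stageLaw G π σ τ 1),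
      belief2 (stageLaw G π σ τ 1) ω.2.2 = f ω.2.1

/-- (A3): if player 1 uses a reduced strategy, then the law `η₂` of `y₂` does not depend on the
strategy of player 2. -/
def A3 (G : Game K I J C D) : Prop :=
  ∀ π ∈ DeltaStar K, ∀ σ : Strategy ℕ I C, IsReduced π σ → ∀ τ τ' : Strategy ℕ J D,
    Phi (stageLaw G π σ τ 1) = Phi (stageLaw G π σ τ' 1)

/-! ### The canonical game -/

/-- The canonical initial distribution `π(k,(p,z),z) = η(z) z(p) p(k)`; the game `Γ̂(η)` is the
game with this initial distribution. -/
def canonical (η : FinDist (Belief2 K)) : FinDist (K × (FinDist K × Belief2 K) × Belief2 K) :=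
  mix η fun z => mix z fun p => p.map fun k => (k, (p, z), z)

/-! ### The auxiliary stochastic game `𝒢` on `X = Δ_f(Δ(K))` -/

/-- Actions of player 1 in `𝒢`: measurable maps from `Δ(K)` to `Δ(I)`. -/
abbrev AuxAct1 (K I : Type*) := {a : FinDist K → FinDist I // Measurable a}

/-- The stage payoff `G(z,a,b)` of `𝒢`. -/
def auxG (G : Game K I J C D) (z : Belief2 K) (a : AuxAct1 K I) (b : FinDist J) : ℝ :=
  expect z fun p => expect (a.1 p) fun i => expect b fun j => expect p fun k => G.g k i j

/-- The law `Q(z,a,b)` of `(k₂, (p, i₁, c₂), (j₁, d₂))` in `Γ̂(z)` when the players use `a` and `b`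
at the first stage. -/
def auxQ (G : Game K I J C D) (z : Belief2 K) (a : AuxAct1 K I) (b : FinDist J) :
    FinDist (K × (FinDist K × I × C) × (J × D)) :=
  mix z fun p => mix p fun k => mix (a.1 p) fun i => mix b fun j =>
    (G.q k i j).map fun r => (r.1, (p, i, r.2.1), (j, r.2.2))

/-- The transition `ℓ(z,a,b) = Φ(Q(z,a,b))` of `𝒢`. -/
def auxTransition (G : Game K I J C D) (z : Belief2 K) (a : AuxAct1 K I) (b : FinDist J) :
    FinDist (Belief2 K) := Phi (auxQ G z a b)

/-- A history of `𝒢`: the list of the past triples (state, action of player 1, action of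
player 2), the most recent one at the head, and the current state. -/
abbrev AuxHistory (K I J : Type*) := List (Belief2 K × AuxAct1 K I × FinDist J) × Belief2 K

/-- Strategies of player 1 in `𝒢`. -/
abbrev AuxStrategy1 (K I J : Type*) := AuxHistory K I J → AuxAct1 K I

/-- Strategies of player 2 in `𝒢`. -/
abbrev AuxStrategy2 (K I J : Type*) := AuxHistory K I J → FinDist J

/-- The Markov strategy of player 1 in `𝒢` that plays `ψ t z` at stage `t + 1` in state `z`. -/
def markovStrategy (ψ : ℕ → Belief2 K → AuxAct1 K I) : AuxStrategy1 K I J :=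
  fun h => ψ h.1.length h.2

/-- The law of the history of `𝒢` at stage `t + 1`, starting from the state `z`. -/
def auxLaw (G : Game K I J C D) (z : Belief2 K) (s : AuxStrategy1 K I J)
    (r : AuxStrategy2 K I J) : ℕ → FinDist (AuxHistory K I J)
  | 0 => StdSimplex.single ([], z)
  | t + 1 => mix (auxLaw G z s r t) fun h =>
      (auxTransition G h.2 (s h) (r h)).map fun z' => ((h.2, s h, r h) :: h.1, z')

/-- The expected average payoff of the first `n` stages of `𝒢`, starting from the state `z`. -/
def auxAvgPayoff (G : Game K I J C D) (z : Belief2 K) (s : AuxStrategy1 K I J)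
    (r : AuxStrategy2 K I J) (n : ℕ) : ℝ :=
  (∑ t ∈ Finset.range n, expect (auxLaw G z s r t) fun h => auxG G h.2 (s h) (r h)) / n

/-- The strategy `s` of player 1 guarantees the amount `w` in `𝒢_∞(z)`. -/
def AuxGuarantees (G : Game K I J C D) (z : Belief2 K) (s : AuxStrategy1 K I J) (w : ℝ) : Prop :=
  ∃ N : ℕ, ∀ n ≥ N, ∀ r : AuxStrategy2 K I J, w ≤ auxAvgPayoff G z s r n

/-- `σ` is induced by the Markov strategy `ψ` in the game `Γ̂(z)`: whatever player 2 does, at every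
stage `n` the mixed action `σ(h^I_n)` is a.s. equal to `ψ_n(y_n)(x_n)`, where `x_n` is the first
order belief of player 1 and `y_n` the second order belief of player 2 under `(σ, τ)`. -/
def InducedBy (G : Game K I J C D) (z : Belief2 K) (ψ : ℕ → Belief2 K → AuxAct1 K I)
    (σ : Strategy (FinDist K × Belief2 K) I C) : Prop :=
  ∀ (τ : Strategy (Belief2 K) J D) (t : ℕ),
    ∀ ω ∈ supp (stageLaw G (canonical (StdSimplex.single z)) σ τ t),
      σ ω.2.1 =
        (ψ t (belief2 (stageLaw G (canonical (StdSimplex.single z)) σ τ t) ω.2.2)).1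
          (belief1 (stageLaw G (canonical (StdSimplex.single z)) σ τ t) ω.2.1)

end RepGame

end

open RepGame

noncomputable section

namespace RepGame

/-! ### Calculus of expectations -/

section Expect

variable {α β γ δ : Type*}

/-! The pair of beliefs reduces the repeated game to the auxiliary stochastic game. (A1), tested at
arbitrary beliefs with trivial initial signals and uniform play, yields an update map `F`
(`exists_isUpdate`): the next belief of player 1 depends only on his belief, action and signal, even
conditionally on what player 2 knows. Hence `filter1` is the conditional law of the state given both
private histories (`isCond_filter1`). From the viewpoint of player 2, player 1 uses at each stage
some map from beliefs to mixed actions (`exists_isSeenAs`), so that, conditionally on his history,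
the current stage is a first stage of the canonical game at `y_t`. Thus `y_t` moves according to the
transition of the auxiliary game and the stage payoff is the expectation of `auxG`
(`expect_belief2_stageLaw_succ`, `stagePayoff_eq_auxG`).

Encoding canonical signals by integers transfers (A2) and (A3) to every state `z`: player 2 does not
influence the transition (`auxTransition_eq`), and player 1 can compute the next `y`
(`exists_belief2_auxQ_eq`). Player 1 can therefore implement any Markov strategy
(`inducedStrategy_spec`). Since player 2 controls no transition, his stagewise minimal payoff `gMin`
is a best reply for all horizons at once, and it gives the same number `markovPayoff` in both games.
This is the first assertion.

For the second, let `dp` be the value function of the resulting one-player problem in which only the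
last `n` of `m + n` stages count. Against a known strategy of player 1, stagewise best replies hold
the payoff of the block to the expectation of `dp` at the initial belief, whatever player 2 did
before the block (`exists_reply_sum_le_dp`); near-optimal Markov strategies show that this is at
most `n * value G π m n` (`expect_dp_le_value`). Payoffs are affine in realization likelihoods and
continuous on a compact product of simplices, so a minimax argument makes one continuation good
against all strategies of player 1 (`exists_uniform_reply`). As earlier play is arbitrary, such
continuations can be pasted over consecutive blocks (`exists_block_strategy`); an almost minimizing
block length `n` in `vStar` concludes. -/

lemma expect_eq (μ : FinDist α) (f : α → ℝ) :
    expect μ f = ∑ a ∈ μ.weights.support, μ.weights a * f a := rfl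

lemma expect_map (μ : FinDist α) (g : α → β) (f : β → ℝ) :
    expect (μ.map g) f = expect μ fun a => f (g a) := by
  unfold expect
  rw [StdSimplex.weights_map, Finsupp.sum_mapDomain_index] <;> simp [add_mul]

lemma expect_mix (μ : FinDist α) (κ : α → FinDist β) (f : β → ℝ) :
    expect (mix μ κ) f = expect μ fun a => expect (κ a) f := by
  unfold mix StdSimplex.iConvexComb expect
  rw [StdSimplex.weights_sConvexComb, Finsupp.sum_sum_index (by simp) (by simp [add_mul]),
    StdSimplex.weights_map, Finsupp.sum_mapDomain_index]
  · refine Finsupp.sum_congr fun a _ => ?_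
    rw [Finsupp.sum_smul_index (by simp), Finsupp.mul_sum]
    simp only [mul_assoc]
  · intro b; simp
  · intro b r s
    rw [Finsupp.sum_smul_index (by simp), Finsupp.sum_smul_index (by simp),
      Finsupp.sum_smul_index (by simp)]
    simp only [Finsupp.sum, ← Finset.sum_add_distrib, add_mul]

lemma expect_single (a : α) (f : α → ℝ) : expect (StdSimplex.single a) f = f a := by
  simp [expect]

lemma expect_const (μ : FinDist α) (r : ℝ) : expect μ (fun _ => r) = r := by
  unfold expect
  rw [Finsupp.sum, ← Finset.sum_mul]
  have := μ.total
  rw [Finsupp.sum] at this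
  rw [this, one_mul]

lemma expect_add (μ : FinDist α) (f g : α → ℝ) :
    expect μ (fun a => f a + g a) = expect μ f + expect μ g := by
  simp only [expect_eq, mul_add, Finset.sum_add_distrib]

lemma expect_const_mul (μ : FinDist α) (r : ℝ) (f : α → ℝ) :
    expect μ (fun a => r * f a) = r * expect μ f := by
  simp only [expect_eq, Finset.mul_sum]
  exact Finset.sum_congr rfl fun a _ => by ring

lemma expect_mul_const (μ : FinDist α) (r : ℝ) (f : α → ℝ) :
    expect μ (fun a => f a * r) = expect μ f * r := by
  rw [mul_comm, ← expect_const_mul]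
  simp only [mul_comm]

lemma expect_sum {ι : Type*} (s : Finset ι) (μ : FinDist α) (f : ι → α → ℝ) :
    expect μ (fun a => ∑ i ∈ s, f i a) = ∑ i ∈ s, expect μ (f i) := by
  simp only [expect_eq, Finset.mul_sum]
  exact Finset.sum_comm

lemma expect_congr {μ : FinDist α} {f g : α → ℝ} (h : ∀ a ∈ supp μ, f a = g a) :
    expect μ f = expect μ g :=
  Finset.sum_congr rfl fun a ha => by
    simp only [h a (by simpa [supp] using ha)]

lemma expect_mono {μ : FinDist α} {f g : α → ℝ} (h : ∀ a ∈ supp μ, f a ≤ g a) :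
    expect μ f ≤ expect μ g :=
  Finset.sum_le_sum fun a ha =>
    mul_le_mul_of_nonneg_left (h a (by simpa [supp] using ha)) (μ.weights_nonneg a)

lemma expect_le_of_le {μ : FinDist α} {f : α → ℝ} {r : ℝ} (h : ∀ a ∈ supp μ, f a ≤ r) :
    expect μ f ≤ r :=
  (expect_mono h).trans_eq (expect_const μ r)

lemma le_expect_of_le {μ : FinDist α} {f : α → ℝ} {r : ℝ} (h : ∀ a ∈ supp μ, r ≤ f a) :
    r ≤ expect μ f :=
  (expect_const μ r).symm.trans_le (expect_mono h)

lemma expect_comm (μ : FinDist α) (ν : FinDist β) (f : α → β → ℝ) :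
    expect μ (fun a => expect ν (f a)) = expect ν fun b => expect μ fun a => f a b := by
  simp only [expect_eq, Finset.mul_sum]
  rw [Finset.sum_comm]
  exact Finset.sum_congr rfl fun a _ => Finset.sum_congr rfl fun b _ => by ring

lemma expect_eq_sum [Fintype α] (μ : FinDist α) (f : α → ℝ) :
    expect μ f = ∑ a, μ.weights a * f a :=
  Finsupp.sum_fintype _ _ (by simp)

lemma expect_indicator [DecidableEq α] (μ : FinDist α) (a : α) :
    expect μ (fun b => if b = a then 1 else 0) = μ.weights a := by
  rw [expect_eq]
  simpa using Eq.symm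

lemma finDist_ext {μ ν : FinDist α} (h : ∀ f : α → ℝ, expect μ f = expect ν f) : μ = ν := by
  classical
  ext a
  rw [← expect_indicator μ a, ← expect_indicator ν a, h]

lemma weights_pos {μ : FinDist α} {a : α} (h : a ∈ supp μ) : 0 < μ.weights a :=
  lt_of_le_of_ne (μ.weights_nonneg a) (Ne.symm h)

lemma supp_finite (μ : FinDist α) : (supp μ).Finite :=
  μ.weights.support.finite_toSet.subset fun a ha => by simpa [supp] using ha

lemma expect_pos {μ : FinDist α} {f : α → ℝ} (h0 : ∀ a, 0 ≤ f a) {a : α} (ha : a ∈ supp μ)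
    (hf : 0 < f a) : 0 < expect μ f :=
  Finset.sum_pos' (fun b _ => mul_nonneg (μ.weights_nonneg b) (h0 b))
    ⟨a, by simpa [supp] using ha, mul_pos (weights_pos ha) hf⟩

lemma exists_supp_of_expect_ne_zero {μ : FinDist α} {f : α → ℝ} (h : expect μ f ≠ 0) :
    ∃ a ∈ supp μ, f a ≠ 0 := by
  by_contra! hc
  exact h ((expect_congr hc).trans (expect_const μ 0))

lemma supp_map {μ : FinDist α} {f : α → β} : supp (μ.map f) = f '' supp μ := by
  classical
  ext b
  constructor
  · intro hb
    have : expect (μ.map f) (fun b' => if b' = b then 1 else 0) ≠ 0 := by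
      rw [expect_indicator]; exact hb
    rw [expect_map] at this
    obtain ⟨a, ha, h⟩ := exists_supp_of_expect_ne_zero this
    exact ⟨a, ha, by by_contra h'; simp [h'] at h⟩
  · rintro ⟨a, ha, rfl⟩
    have : 0 < expect (μ.map f) (fun b' => if b' = f a then 1 else 0) := by
      rw [expect_map]
      exact expect_pos (fun _ => by positivity) ha (by simp)
    rw [expect_indicator] at this
    exact this.ne'

lemma supp_mix {μ : FinDist α} {κ : α → FinDist β} {b : β} :
    b ∈ supp (mix μ κ) ↔ ∃ a ∈ supp μ, b ∈ supp (κ a) := by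
  classical
  constructor
  · intro hb
    have : expect (mix μ κ) (fun b' => if b' = b then 1 else 0) ≠ 0 := by
      rw [expect_indicator]; exact hb
    rw [expect_mix] at this
    obtain ⟨a, ha, h⟩ := exists_supp_of_expect_ne_zero this
    rw [expect_indicator] at h
    exact ⟨a, ha, h⟩
  · rintro ⟨a, ha, hb⟩
    have : 0 < expect (mix μ κ) (fun b' => if b' = b then 1 else 0) := by
      rw [expect_mix]
      refine expect_pos (a := a) (fun _ => ?_) ha ?_
      · rw [expect_indicator]; exact StdSimplex.weights_nonneg _
      · rw [expect_indicator]; exact weights_pos hb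
    rw [expect_indicator] at this
    exact this.ne'

lemma supp_single {a : α} : supp (StdSimplex.single (R := ℝ) a) = {a} := by
  classical
  ext b
  simp [supp, Finsupp.single_apply, eq_comm]

lemma mix_congr {μ : FinDist α} {κ κ' : α → FinDist β} (h : ∀ a ∈ supp μ, κ a = κ' a) :
    mix μ κ = mix μ κ' :=
  finDist_ext fun f => by
    rw [expect_mix, expect_mix]
    exact expect_congr fun a ha => by rw [h a ha]

lemma exists_mem_supp (μ : FinDist α) : ∃ a, a ∈ supp μ := by
  obtain ⟨a, ha⟩ := μ.support_weights_nonempty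
  exact ⟨a, by simpa [supp] using ha⟩

/-! ### Conditional laws -/

/-- `κ` is a version of the conditional law of `f` given `g` under `μ`. -/
def IsCond (μ : FinDist α) (f : α → β) (g : α → γ) (κ : γ → FinDist β) : Prop :=
  ∀ Ψ : γ → β → ℝ, expect μ (fun a => Ψ (g a) (f a)) =
    expect μ fun a => expect (κ (g a)) (Ψ (g a))

open Classical in
lemma expect_eq_sum_fibers (μ : FinDist α) (g : α → γ) (F : α → ℝ) :
    expect μ F = ∑ c ∈ μ.weights.support.image g, expect μ fun a => if g a = c then F a else 0 := by
  rw [← expect_sum]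
  refine expect_congr fun a ha => ?_
  rw [Finset.sum_ite_eq, if_pos]
  exact Finset.mem_image_of_mem _ (by simpa [supp] using ha)

/-- Finite support splits every expectation into finitely many fibres of `g`. The multiplied form
makes sense on null fibres as well. -/
lemma isCond_iff (μ : FinDist α) (f : α → β) (g : α → γ) (κ : γ → FinDist β) [DecidableEq γ] :
    IsCond μ f g κ ↔ ∀ c φ, expect μ (fun a => if g a = c then φ (f a) else 0) =
      expect μ (fun a => if g a = c then (1 : ℝ) else 0) * expect (κ c) φ := by
  constructor
  · intro h c φ
    have := h fun c' b => if c' = c then φ b else 0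
    rw [this, ← expect_mul_const]
    refine expect_congr fun a _ => ?_
    split_ifs with h'
    · rw [h', one_mul]
    · rw [expect_const, zero_mul]
  · intro h Ψ
    rw [expect_eq_sum_fibers μ g, expect_eq_sum_fibers μ g (fun a => expect (κ (g a)) (Ψ (g a)))]
    refine Finset.sum_congr rfl fun c _ => ?_
    have h1 := h c (Ψ c)
    convert h1 using 1
    · exact expect_congr fun a _ => by
        by_cases h' : g a = c <;> simp [h']
    · rw [← expect_mul_const]
      exact expect_congr fun a _ => by
        by_cases h' : g a = c <;> simp [h']

open Classical in
lemma expect_restrict (μ : FinDist α) (s : Set α) (h : ∃ a ∈ s, μ.weights a ≠ 0) (φ : α → ℝ) :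
    expect μ (fun a => if a ∈ s then φ a else 0) =
      expect μ (fun a => if a ∈ s then (1 : ℝ) else 0) * expect (μ.restrict s h) φ := by
  have key : ∀ φ : α → ℝ, expect μ (fun a => if a ∈ s then φ a else 0) =
      (μ.weights.filter (· ∈ s)).sum fun a r => r * φ a := by
    intro φ
    rw [Finsupp.sum, Finsupp.support_filter, Finset.sum_filter, expect_eq]
    refine Finset.sum_congr rfl fun a _ => ?_
    by_cases ha : a ∈ s <;> simp [ha]
  have h1 : expect μ (fun a => if a ∈ s then (1 : ℝ) else 0) =
      (μ.weights.filter (· ∈ s)).sum fun _ r => r := by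
    rw [key]; simp
  have hpos : 0 < expect μ (fun a => if a ∈ s then (1 : ℝ) else 0) := by
    obtain ⟨a, ha, h0⟩ := h
    exact expect_pos (fun _ => by positivity) (a := a) h0 (by simp [ha])
  have hr : expect (μ.restrict s h) φ = (μ.restrict s h).weights.sum fun a r => r * φ a := rfl
  rw [key, hr, StdSimplex.weights_restrict, Finsupp.sum_smul_index (by simp), ← h1]
  simp only [mul_assoc]
  rw [← Finsupp.mul_sum, mul_inv_cancel_left₀ hpos.ne']

lemma isCond_condLaw (μ : FinDist α) (f : α → β) (g : α → γ) :
    IsCond μ f g (condLaw μ f g) := by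
  classical
  rw [isCond_iff]
  intro c φ
  by_cases h : ∃ a ∈ {a | g a = c}, μ.weights a ≠ 0
  · rw [condLaw, dif_pos h, expect_map]
    exact expect_restrict μ {a | g a = c} h fun a => φ (f a)
  -- On a null fibre both sides vanish, so the default value in `condLaw` is immaterial.
  · push Not at h
    have h0 : ∀ F : α → ℝ, expect μ (fun a => if g a = c then F a else 0) = 0 := fun F => by
      refine (expect_congr fun a ha => ?_).trans (expect_const μ 0)
      exact if_neg fun h' => ha (h a h')
    rw [h0, h0, zero_mul]

/-- Almost sure uniqueness of conditional laws: the fibre of a support point has positive mass,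
which cancels. Beliefs are identified below by exhibiting a version and applying this. -/
lemma IsCond.eq {μ : FinDist α} {f : α → β} {g : α → γ} {κ : γ → FinDist β}
    (h : IsCond μ f g κ) {a : α} (ha : a ∈ supp μ) : condLaw μ f g (g a) = κ (g a) := by
  classical
  refine finDist_ext fun φ => ?_
  have h1 := (isCond_iff μ f g κ).1 h (g a) φ
  rw [(isCond_iff μ f g _).1 (isCond_condLaw μ f g) (g a) φ] at h1
  exact mul_left_cancel₀ (expect_pos (fun _ => by positivity) ha (by simp)).ne' h1

lemma IsCond.congr {μ : FinDist α} {f f' : α → β} {g : α → γ} {κ κ' : γ → FinDist β}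
    (h : IsCond μ f g κ) (hf : ∀ a ∈ supp μ, f a = f' a)
    (hκ : ∀ a ∈ supp μ, κ (g a) = κ' (g a)) : IsCond μ f' g κ' := by
  intro Ψ
  refine ((expect_congr fun a ha => ?_).trans (h Ψ)).trans (expect_congr fun a ha => ?_)
  · rw [hf a ha]
  · rw [hκ a ha]

/-- If the conditional law given `g` depends on `g'` only, it is the conditional law given `g'`. -/
lemma IsCond.coarsen {μ : FinDist α} {f : α → β} {g : α → γ} {e : γ → δ} {κ : δ → FinDist β}
    (h : IsCond μ f g fun c => κ (e c)) : IsCond μ f (fun a => e (g a)) κ :=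
  fun Ψ => h fun c => Ψ (e c)

/-- Averages of `φ` over the conditional law of `f` given `g`. -/
lemma exists_condAction {ι : Type*} (μ : FinDist α) (g : α → γ) (σ : α → FinDist ι) :
    ∃ A : γ → FinDist ι, ∀ Ψ : γ → ι → ℝ,
      expect μ (fun a => expect (σ a) (Ψ (g a))) = expect μ fun a => expect (A (g a)) (Ψ (g a)) := by
  refine ⟨fun c => mix (condLaw μ id g c) σ, fun Ψ => ?_⟩
  simp only [expect_mix]
  exact isCond_condLaw μ id g fun c a => expect (σ a) (Ψ c)

end Expect

variable {K I J C D S T : Type*}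

/-! ### Distributions on finite sets -/

/-- The distribution on a finite set with given weights. -/
def ofWeights {α : Type*} [Fintype α] (p : α → ℝ) (h0 : ∀ a, 0 ≤ p a) (h1 : ∑ a, p a = 1) :
    FinDist α where
  weights := Finsupp.equivFunOnFinite.symm p
  nonneg := fun a => h0 a
  total := by rw [Finsupp.sum_fintype _ _ (by simp)]; exact h1

@[simp]
lemma ofWeights_weights {α : Type*} [Fintype α] (p : α → ℝ) (h0 : ∀ a, 0 ≤ p a)
    (h1 : ∑ a, p a = 1) (a : α) : (ofWeights p h0 h1).weights a = p a := rfl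

/-- The uniform distribution on a finite set. -/
def uniformDist (α : Type*) [Fintype α] [Nonempty α] : FinDist α :=
  ofWeights (fun _ => (Fintype.card α : ℝ)⁻¹) (fun _ => by positivity) (by simp)

lemma uniformDist_weights {α : Type*} [Fintype α] [Nonempty α] (a : α) :
    (uniformDist α).weights a = (Fintype.card α : ℝ)⁻¹ := rfl

lemma uniformDist_pos {α : Type*} [Fintype α] [Nonempty α] (a : α) :
    0 < (uniformDist α).weights a := by
  rw [uniformDist_weights]; positivity

/-! ### The belief of player 1 -/

/-- The belief of player 1 on the next state is a function of his belief on the current state, of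
his action and of his signal, whatever player 2 does and observes. -/
def IsUpdate (G : Game K I J C D) (F : FinDist K → I → C → FinDist K) : Prop :=
  ∀ x i j, IsCond (mix x fun k => G.q k i j) (fun r => r.1) (fun r => r.2) fun cd => F x i cd.1

lemma expect_stageLaw_succ (G : Game K I J C D) (π : FinDist (K × S × T)) (σ : Strategy S I C)
    (τ : Strategy T J D) (t : ℕ) (f : K × History S I C × History T J D → ℝ) :
    expect (stageLaw G π σ τ (t + 1)) f = expect (stageLaw G π σ τ t) fun ω =>
      expect (σ ω.2.1) fun i => expect (τ ω.2.2) fun j => expect (G.q ω.1 i j) fun r =>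
        f (r.1, (ω.2.1.1, (i, r.2.1) :: ω.2.1.2), (ω.2.2.1, (j, r.2.2) :: ω.2.2.2)) := by
  simp only [stageLaw, expect_mix, expect_map]

lemma expect_ite_eq {α : Type*} [DecidableEq α] (μ : FinDist α) (a : α) (r : ℝ) :
    expect μ (fun b => if b = a then r else 0) = μ.weights a * r := by
  rw [← expect_indicator, ← expect_mul_const]
  exact expect_congr fun b _ => by split_ifs <;> simp

/-- Uninformative signals let an arbitrary belief `x` be the belief of player 1 at the start, so
that (A1) can be tested at every `x`. -/
lemma single_signal_mem_deltaStar (x : FinDist K) :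
    x.map (fun k => (k, (0 : ℕ), (0 : ℕ))) ∈ DeltaStar K := by
  classical
  constructor
  · intro k c d
    have h : ∀ {β : Type _} [DecidableEq β] (f : K × ℕ × ℕ → β) (b : β),
        ((x.map (fun k => (k, (0 : ℕ), (0 : ℕ)))).map f).weights b =
          expect x fun k => if f (k, 0, 0) = b then 1 else 0 := by
      intro β _ f b
      rw [← expect_indicator, expect_map, expect_map]
    have h₂ : ((x.map (fun k => (k, (0 : ℕ), (0 : ℕ)))).map fun ω => (ω.1, ω.2.1)).weights (k, c) =
          expect x fun k' => if (k', 0) = (k, c) then 1 else 0 := by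
      rw [← expect_indicator, expect_map, expect_map]
    have h' : (x.map (fun k => (k, (0 : ℕ), (0 : ℕ)))).weights (k, c, d) =
        expect x fun k' => if (k', 0, 0) = (k, c, d) then 1 else 0 := by
      rw [← expect_indicator, expect_map]
    rw [h, h, h₂, h']
    by_cases hc : c = 0
    · by_cases hd : d = 0
      · subst hc hd
        simp [expect_const]
      · simp [Ne.symm hd, expect_const]
    · simp [Ne.symm hc, expect_const]
  · refine ⟨fun _ => belief2 (x.map (fun k => (k, (0 : ℕ), (0 : ℕ)))) 0, fun ω hω => ?_⟩
    rw [supp_map] at hω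
    obtain ⟨k, -, rfl⟩ := hω
    rfl

/-- Under uniform play every action pair has positive probability. Restricting the second-stage law
to one pair `(i₀, j₀)` gives the one-step law from `x`, and (A1) says that the conditional law of
the state there ignores what player 2 did and saw. -/
lemma exists_isUpdate [Finite I] [Finite J] [Nonempty I] [Nonempty J] {G : Game K I J C D}
    (hA1 : A1 G) : ∃ F, IsUpdate G F := by
  classical
  have := Fintype.ofFinite I
  have := Fintype.ofFinite J
  let μ : FinDist K → FinDist (K × History ℕ I C × History ℕ J D) := fun x =>
    stageLaw G (x.map fun k => (k, (0 : ℕ), (0 : ℕ))) (fun _ => uniformDist I)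
      (fun _ => uniformDist J) 1
  refine ⟨fun x i c => condLaw (μ x) (fun ω => ω.1) (fun ω => ω.2.1) (0, [(i, c)]),
    fun x i₀ j₀ Ψ => ?_⟩
  have h : IsCond (μ x) (fun ω => ω.1) (fun ω => ω.2)
      fun h => condLaw (μ x) (fun ω => ω.1) (fun ω => ω.2.1) h.1 :=
    (isCond_condLaw (μ x) _ _).congr (fun _ _ => rfl) fun ω hω =>
      hA1 _ (single_signal_mem_deltaStar x) _ _ 1 ω hω
  -- Test functions supported on the action pair `(i₀, j₀)`; the probability of this pair under
  -- uniform play factors out.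
  have key : ∀ f : I → C → J → D → K → ℝ,
      expect (μ x) (fun ω => match ω.2.1.2, ω.2.2.2 with
        | [(i, c)], [(j, d)] => if i = i₀ then if j = j₀ then f i c j d ω.1 else 0 else 0
        | _, _ => 0) =
      (uniformDist I).weights i₀ * (uniformDist J).weights j₀ *
        expect (mix x fun k => G.q k i₀ j₀) fun r => f i₀ r.2.1 j₀ r.2.2 r.1 := by
    intro f
    simp only [μ]
    rw [expect_stageLaw_succ, expect_mix, ← expect_const_mul]
    simp only [stageLaw, expect_map]
    refine expect_congr fun k _ => ?_
    rw [mul_assoc, ← expect_ite_eq]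
    refine expect_congr fun i _ => ?_
    by_cases hi : i = i₀
    · simp only [hi, if_true]
      rw [← expect_ite_eq]
      refine expect_congr fun j _ => ?_
      by_cases hj : j = j₀
      · simp only [hj, if_true]
      · simp only [hj, if_false, expect_const]
    · simp only [hi, if_false, expect_const]
  have h1 := h fun h k => match h.1.2, h.2.2 with
    | [(i, c)], [(j, d)] => if i = i₀ then if j = j₀ then Ψ (c, d) k else 0 else 0
    | _, _ => 0
  rw [key fun _ c _ d k => Ψ (c, d) k] at h1
  have h2 := key fun i c _ d _ =>
    expect (condLaw (μ x) (fun ω => ω.1) (fun ω => ω.2.1) (0, [(i, c)])) (Ψ (c, d))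
  have hne : (uniformDist I).weights i₀ * (uniformDist J).weights j₀ ≠ 0 :=
    (mul_pos (uniformDist_pos _) (uniformDist_pos _)).ne'
  refine mul_left_cancel₀ hne (h1.trans (Eq.trans ?_ h2))
  have hs : ∀ ω ∈ supp (μ x), ω.2.1.1 = 0 := by
    intro ω hω
    simp only [μ, stageLaw, supp_mix, supp_map] at hω
    obtain ⟨ω', ⟨ω₀, ⟨k, _, rfl⟩, rfl⟩, i, _, j, _, r, _, rfl⟩ := hω
    rfl
  refine expect_congr fun ω hω => ?_
  obtain ⟨k, ⟨s, l⟩, ⟨s', l'⟩⟩ := ω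
  have : s = 0 := hs _ hω
  subst this
  match l, l' with
  | [], _ => simp [expect_const]
  | [(i, c)], [] => simp [expect_const]
  | [(i, c)], [(j, d)] =>
    by_cases hi : i = i₀ <;> by_cases hj : j = j₀ <;> simp [hi, hj, expect_const]
  | [(i, c)], _ :: _ :: _ => simp [expect_const]
  | _ :: _ :: _, _ => simp [expect_const]

/-- The belief of player 1 after a private history, when `x₀` is his belief after the initial
signal. -/
def filter1 (F : FinDist K → I → C → FinDist K) (x₀ : S → FinDist K) (h : History S I C) :
    FinDist K :=
  h.2.foldr (fun a x => F x a.1 a.2) (x₀ h.1)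

/-- `x₀` is the belief of player 1 given the initial signals of both players. -/
def IsInitialBelief (π : FinDist (K × S × T)) (x₀ : S → FinDist K) : Prop :=
  IsCond π (fun ω => ω.1) (fun ω => ω.2) fun cd => x₀ cd.1

/-- (A1a) is conditional independence of the state and the signal of player 2 given that of player
1; dividing by the probability of `c` is possible unless `c` is null, where all terms vanish. -/
lemma isInitialBelief_of_A1a [Finite K] {π : FinDist (K × S × T)} (h : A1a π) :
    IsInitialBelief π (belief1 π) := by
  classical
  have := Fintype.ofFinite K
  rw [IsInitialBelief, isCond_iff]
  rintro ⟨c, d⟩ φ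
  have h1 : ∀ k, (π.map fun ω => (ω.1, ω.2.1)).weights (k, c) =
      (π.map fun ω => ω.2.1).weights c * (belief1 π c).weights k := by
    intro k
    have := (isCond_iff π (fun ω => ω.1) (fun ω => ω.2.1) _).1 (isCond_condLaw π _ _) c
      fun k' => if k' = k then 1 else 0
    rw [expect_indicator] at this
    rw [← expect_indicator, ← expect_indicator, expect_map, expect_map]
    refine Eq.trans ?_ this
    refine expect_congr fun ω _ => ?_
    by_cases h1 : ω.1 = k <;> by_cases h2 : ω.2.1 = c <;> simp [h1, h2]
  have h2 : expect π (fun a => if a.2 = (c, d) then (1 : ℝ) else 0) =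
      (π.map fun ω => ω.2).weights (c, d) := by
    rw [← expect_indicator, expect_map]
  have h3 : expect π (fun a => if a.2 = (c, d) then φ a.1 else 0) =
      ∑ k, φ k * π.weights (k, c, d) := by
    simp only [← expect_indicator, ← expect_const_mul]
    rw [← expect_sum]
    refine expect_congr fun ω _ => ?_
    obtain ⟨k, c', d'⟩ := ω
    by_cases hcd : (c', d') = (c, d)
    · cases hcd
      simp
    · simp [hcd]
  rw [h2, h3]
  by_cases hc : (π.map fun ω => ω.2.1).weights c = 0
  · have h4 : ∀ ω ∈ supp π, ω.2.1 ≠ c := by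
      intro ω hω hωc
      have : c ∈ supp (π.map fun ω => ω.2.1) := by rw [supp_map]; exact ⟨ω, hω, hωc⟩
      exact this hc
    have h5 : (π.map fun ω => ω.2).weights (c, d) = 0 := by
      rw [← h2]
      refine (expect_congr fun ω hω => ?_).trans (expect_const π 0)
      exact if_neg fun h' => h4 ω hω (by rw [h'])
    have h6 : ∀ k, π.weights (k, c, d) = 0 := fun k => by
      by_contra h'
      exact h4 _ h' rfl
    rw [h5]; simp [h6]
  · have h4 : ∀ k, π.weights (k, c, d) =
        (belief1 π c).weights k * (π.map fun ω => ω.2).weights (c, d) := fun k => by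
      have := h k c d
      rw [h1, mul_assoc] at this
      exact mul_left_cancel₀ hc this
    rw [expect_eq_sum, Finset.mul_sum]
    refine Finset.sum_congr rfl fun k _ => ?_
    rw [h4]; ring

section Step

variable {G : Game K I J C D} {F : FinDist K → I → C → FinDist K} {π : FinDist (K × S × T)}
  {x₀ : S → FinDist K}

/-- Mixed actions depend only on the private histories, so actions reveal nothing more about the
state. The next state is thus drawn from the mixture of `q` over the current filter, and `IsUpdate`
conditions it on both new signals. -/
lemma isCond_filter1 (hF : IsUpdate G F) (hx : IsInitialBelief π x₀) (σ : Strategy S I C)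
    (τ : Strategy T J D) (t : ℕ) :
    IsCond (stageLaw G π σ τ t) (fun ω => ω.1) (fun ω => ω.2) fun h => filter1 F x₀ h.1 := by
  induction t with
  | zero =>
    intro Ψ
    simp only [stageLaw, expect_map]
    exact hx fun cd => Ψ ((cd.1, []), (cd.2, []))
  | succ t ih =>
    -- By the induction hypothesis the current state may be replaced by its conditional law given
    -- both histories.
    have key : ∀ f : K × History S I C × History T J D → ℝ,
        expect (stageLaw G π σ τ (t + 1)) f = expect (stageLaw G π σ τ t) fun ω =>
          expect (σ ω.2.1) fun i => expect (τ ω.2.2) fun j =>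
            expect (mix (filter1 F x₀ ω.2.1) fun k => G.q k i j) fun r =>
              f (r.1, (ω.2.1.1, (i, r.2.1) :: ω.2.1.2), (ω.2.2.1, (j, r.2.2) :: ω.2.2.2)) := by
      intro f
      rw [expect_stageLaw_succ]
      refine (ih fun h k => expect (σ h.1) fun i => expect (τ h.2) fun j =>
        expect (G.q k i j) fun r =>
          f (r.1, (h.1.1, (i, r.2.1) :: h.1.2), (h.2.1, (j, r.2.2) :: h.2.2))).trans ?_
      refine expect_congr fun ω _ => ?_
      rw [expect_comm]
      refine expect_congr fun i _ => ?_
      rw [expect_comm]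
      exact expect_congr fun j _ => by rw [expect_mix]
    intro Ψ
    rw [key, key]
    refine expect_congr fun ω _ => expect_congr fun i _ => expect_congr fun j _ => ?_
    exact hF (filter1 F x₀ ω.2.1) i j fun cd k =>
      Ψ ((ω.2.1.1, (i, cd.1) :: ω.2.1.2), (ω.2.2.1, (j, cd.2) :: ω.2.2.2)) k

lemma expect_stageLaw_succ_filter1 (hF : IsUpdate G F) (hx : IsInitialBelief π x₀)
    (σ : Strategy S I C) (τ : Strategy T J D) (t : ℕ)
    (f : History S I C → History T J D → ℝ) :
    expect (stageLaw G π σ τ (t + 1)) (fun ω => f ω.2.1 ω.2.2) =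
      expect (stageLaw G π σ τ t) fun ω =>
        expect (σ ω.2.1) fun i => expect (τ ω.2.2) fun j =>
          expect (mix (filter1 F x₀ ω.2.1) fun k => G.q k i j) fun r =>
            f (ω.2.1.1, (i, r.2.1) :: ω.2.1.2) (ω.2.2.1, (j, r.2.2) :: ω.2.2.2) := by
  rw [expect_stageLaw_succ]
  refine (isCond_filter1 hF hx σ τ t fun h k => expect (σ h.1) fun i => expect (τ h.2) fun j =>
    expect (G.q k i j) fun r =>
      f (h.1.1, (i, r.2.1) :: h.1.2) (h.2.1, (j, r.2.2) :: h.2.2)).trans ?_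
  refine expect_congr fun ω _ => ?_
  rw [expect_comm]
  refine expect_congr fun i _ => ?_
  rw [expect_comm]
  exact expect_congr fun j _ => by rw [expect_mix]

lemma belief1_stageLaw (hF : IsUpdate G F) (hx : IsInitialBelief π x₀) (σ : Strategy S I C)
    (τ : Strategy T J D) (t : ℕ) {ω} (hω : ω ∈ supp (stageLaw G π σ τ t)) :
    belief1 (stageLaw G π σ τ t) ω.2.1 = filter1 F x₀ ω.2.1 :=
  (IsCond.coarsen (e := Prod.fst) (isCond_filter1 hF hx σ τ t)).eq hω

/-- Replaces `belief1`, which refers to the law, by the explicit filter. -/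
lemma isCond_belief2 (hF : IsUpdate G F) (hx : IsInitialBelief π x₀) (σ : Strategy S I C)
    (τ : Strategy T J D) (t : ℕ) :
    IsCond (stageLaw G π σ τ t) (fun ω => filter1 F x₀ ω.2.1) (fun ω => ω.2.2)
      (belief2 (stageLaw G π σ τ t)) :=
  (isCond_condLaw (stageLaw G π σ τ t) (fun ω => belief1 (stageLaw G π σ τ t) ω.2.1)
    fun ω => ω.2.2).congr (fun _ hω => belief1_stageLaw hF hx σ τ t hω) fun _ _ => rfl

/-! ### The one-stage law -/

lemma expect_auxQ (G : Game K I J C D) (z : Belief2 K) (a : AuxAct1 K I) (b : FinDist J)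
    (f : K × (FinDist K × I × C) × (J × D) → ℝ) :
    expect (auxQ G z a b) f = expect z fun p => expect (a.1 p) fun i => expect b fun j =>
      expect (mix p fun k => G.q k i j) fun r => f (r.1, (p, i, r.2.1), (j, r.2.2)) := by
  simp only [auxQ, expect_mix, expect_map]
  refine expect_congr fun p _ => ?_
  rw [expect_comm]
  refine expect_congr fun i _ => ?_
  rw [expect_comm]

lemma isCond_auxQ (hF : IsUpdate G F) (z : Belief2 K) (a : AuxAct1 K I) (b : FinDist J) :
    IsCond (auxQ G z a b) (fun ω => ω.1) (fun ω => ω.2)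
      fun h => F h.1.1 h.1.2.1 h.1.2.2 := by
  intro Ψ
  rw [expect_auxQ, expect_auxQ]
  refine expect_congr fun p _ => expect_congr fun i _ => expect_congr fun j _ => ?_
  exact hF p i j fun cd => Ψ ((p, i, cd.1), (j, cd.2))

lemma belief1_auxQ (hF : IsUpdate G F) (z : Belief2 K) (a : AuxAct1 K I) (b : FinDist J)
    {ω} (hω : ω ∈ supp (auxQ G z a b)) :
    belief1 (auxQ G z a b) ω.2.1 = F ω.2.1.1 ω.2.1.2.1 ω.2.1.2.2 := by
  have h : IsCond (auxQ G z a b) (fun ω => ω.1) (fun ω => ω.2.1)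
      (fun h => F h.1 h.2.1 h.2.2) := (isCond_auxQ hF z a b).coarsen (e := Prod.fst)
  exact h.eq hω

lemma isCond_belief2_auxQ (hF : IsUpdate G F) (z : Belief2 K) (a : AuxAct1 K I)
    (b : FinDist J) :
    IsCond (auxQ G z a b) (fun ω => F ω.2.1.1 ω.2.1.2.1 ω.2.1.2.2) (fun ω => ω.2.2)
      (belief2 (auxQ G z a b)) :=
  (isCond_condLaw (auxQ G z a b) (fun ω => belief1 (auxQ G z a b) ω.2.1)
    fun ω => ω.2.2).congr (fun _ hω => belief1_auxQ hF z a b hω) fun _ _ => rfl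

lemma belief2_auxQ_eq (hF : IsUpdate G F) {z : Belief2 K} {a : AuxAct1 K I} {b : FinDist J}
    {κ : J × D → Belief2 K}
    (h : IsCond (auxQ G z a b) (fun ω => F ω.2.1.1 ω.2.1.2.1 ω.2.1.2.2) (fun ω => ω.2.2) κ)
    {ω} (hω : ω ∈ supp (auxQ G z a b)) : belief2 (auxQ G z a b) ω.2.2 = κ ω.2.2 := by
  have h' : IsCond (auxQ G z a b) (fun ω => belief1 (auxQ G z a b) ω.2.1) (fun ω => ω.2.2) κ :=
    h.congr (fun _ hω => (belief1_auxQ hF z a b hω).symm) fun _ _ => rfl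
  exact h'.eq hω

lemma belief2_stageLaw_eq (hF : IsUpdate G F) (hx : IsInitialBelief π x₀) {σ : Strategy S I C}
    {τ : Strategy T J D} {t : ℕ} {κ : History T J D → Belief2 K}
    (h : IsCond (stageLaw G π σ τ t) (fun ω => filter1 F x₀ ω.2.1) (fun ω => ω.2.2) κ)
    {ω} (hω : ω ∈ supp (stageLaw G π σ τ t)) : belief2 (stageLaw G π σ τ t) ω.2.2 = κ ω.2.2 := by
  have h' : IsCond (stageLaw G π σ τ t) (fun ω => belief1 (stageLaw G π σ τ t) ω.2.1)
      (fun ω => ω.2.2) κ :=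
    h.congr (fun _ hω => (belief1_stageLaw hF hx σ τ t hω).symm) fun _ _ => rfl
  exact h'.eq hω

/-! ### The transition of the beliefs of player 2 -/

/-- `μ` is the law of the current state and of the private histories. Seen by player 2, player 1
uses the action `A h` of the auxiliary game after the private history `h` of player 2. -/
def IsSeenAs (μ : FinDist (K × History S I C × History T J D)) (X : History S I C → FinDist K)
    (σ : Strategy S I C) (A : History T J D → AuxAct1 K I) : Prop :=
  ∀ φ : History T J D → FinDist K → I → ℝ,
    expect μ (fun ω => expect (σ ω.2.1) (φ ω.2.2 (X ω.2.1))) =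
      expect μ fun ω => expect ((A ω.2.2).1 (X ω.2.1)) (φ ω.2.2 (X ω.2.1))

instance [Finite K] : MeasurableSingletonClass (FinDist K) where
  measurableSet_singleton x := by
    have := Fintype.ofFinite K
    refine ⟨{fun k => x.weights k}, measurableSet_singleton _, ?_⟩
    ext y
    simp only [Set.mem_preimage, Set.mem_singleton_iff]
    constructor
    · intro h; ext k; exact congrFun h k
    · rintro rfl; rfl

/-- Measurability of auxiliary actions is no restriction, because only finitely many beliefs have
positive probability. -/
lemma exists_auxAct1_eqOn [Finite K] [Nonempty I] {s : Set (FinDist K)} (hs : s.Finite)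
    (a : FinDist K → FinDist I) : ∃ a' : AuxAct1 K I, ∀ x ∈ s, a'.1 x = a x := by
  classical
  refine ⟨⟨fun x => if x ∈ s then a x else StdSimplex.single (Classical.arbitrary I),
    measurable_of_measurable_on_compl_finite s hs ?_⟩, fun x hx => if_pos hx⟩
  convert measurable_const (a := StdSimplex.single (R := ℝ) (Classical.arbitrary I)) using 1
  ext1 ⟨x, hx⟩
  exact if_neg hx

/-- Average the mixed action of player 1 conditionally on the history of player 2 and the belief of
player 1. -/
lemma exists_isSeenAs [Finite K] [Nonempty I] (μ : FinDist (K × History S I C × History T J D))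
    (X : History S I C → FinDist K) (σ : Strategy S I C) : ∃ A, IsSeenAs μ X σ A := by
  obtain ⟨A₀, hA₀⟩ := exists_condAction μ (fun ω => (ω.2.2, X ω.2.1)) (fun ω => σ ω.2.1)
  have hs : ((fun ω => X ω.2.1) '' supp μ).Finite := (supp_finite _).image _
  choose A hA using fun h => exists_auxAct1_eqOn hs fun x => A₀ (h, x)
  refine ⟨A, fun φ => (hA₀ fun c => φ c.1 c.2).trans ?_⟩
  exact expect_congr fun ω hω => by rw [hA _ _ ⟨ω, hω, rfl⟩]

variable {σ : Strategy S I C} {τ : Strategy T J D} {t : ℕ} {A : History T J D → AuxAct1 K I}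

/-- Given the history of player 2, the belief of player 1 has law `y_t`; together with `A` and `τ`
this is exactly the first stage of the canonical game at `y_t`. -/
lemma expect_stageLaw_succ_auxQ (hF : IsUpdate G F) (hx : IsInitialBelief π x₀)
    (hA : IsSeenAs (stageLaw G π σ τ t) (filter1 F x₀) σ A) (Ψ : History T J D → FinDist K → ℝ) :
    expect (stageLaw G π σ τ (t + 1)) (fun ω => Ψ ω.2.2 (filter1 F x₀ ω.2.1)) =
      expect (stageLaw G π σ τ t) fun ω =>
        expect (auxQ G (belief2 (stageLaw G π σ τ t) ω.2.2) (A ω.2.2) (τ ω.2.2)) fun r =>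
          Ψ (ω.2.2.1, r.2.2 :: ω.2.2.2) (F r.2.1.1 r.2.1.2.1 r.2.1.2.2) := by
  rw [expect_stageLaw_succ_filter1 hF hx σ τ t fun h h' => Ψ h' (filter1 F x₀ h)]
  refine (hA fun h x i => expect (τ h) fun j => expect (mix x fun k => G.q k i j) fun r =>
    Ψ (h.1, (j, r.2.2) :: h.2) (F x i r.2.1)).trans ?_
  refine (isCond_belief2 hF hx σ τ t fun h x => expect ((A h).1 x) fun i => expect (τ h) fun j =>
    expect (mix x fun k => G.q k i j) fun r =>
      Ψ (h.1, (j, r.2.2) :: h.2) (F x i r.2.1)).trans ?_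
  exact expect_congr fun ω _ => by rw [expect_auxQ]

lemma belief2_stageLaw_succ (hF : IsUpdate G F) (hx : IsInitialBelief π x₀)
    (hA : IsSeenAs (stageLaw G π σ τ t) (filter1 F x₀) σ A) {h : History T J D} {r : J × D} {ω}
    (hω : ω ∈ supp (stageLaw G π σ τ (t + 1))) (hωh : ω.2.2 = (h.1, r :: h.2)) :
    belief2 (stageLaw G π σ τ (t + 1)) (h.1, r :: h.2) =
      belief2 (auxQ G (belief2 (stageLaw G π σ τ t) h) (A h) (τ h)) r := by
  -- The value on the empty list is a dummy: after at least one stage, histories of positive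
  -- probability are nonempty.
  let κ : History T J D → Belief2 K := fun h => match h.2 with
    | [] => belief2 (stageLaw G π σ τ t) h
    | r :: l => belief2 (auxQ G (belief2 (stageLaw G π σ τ t) (h.1, l)) (A (h.1, l))
        (τ (h.1, l))) r
  have hκ : IsCond (stageLaw G π σ τ (t + 1)) (fun ω => filter1 F x₀ ω.2.1) (fun ω => ω.2.2)
      κ := by
    intro Ψ
    rw [expect_stageLaw_succ_auxQ hF hx hA Ψ,
      expect_stageLaw_succ_auxQ hF hx hA fun h _ => expect (κ h) (Ψ h)]
    refine expect_congr fun ω _ => ?_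
    exact isCond_belief2_auxQ hF _ _ _ fun r x => Ψ (ω.2.2.1, r :: ω.2.2.2) x
  have := belief2_stageLaw_eq hF hx hκ hω
  rwa [hωh] at this

lemma exists_pred_of_mem_supp_succ {ω} (hω : ω ∈ supp (stageLaw G π σ τ (t + 1))) :
    ∃ ω' ∈ supp (stageLaw G π σ τ t), ∃ i ∈ supp (σ ω'.2.1), ∃ j ∈ supp (τ ω'.2.2),
      ∃ r ∈ supp (G.q ω'.1 i j), ω = (r.1, (ω'.2.1.1, (i, r.2.1) :: ω'.2.1.2),
        (ω'.2.2.1, (j, r.2.2) :: ω'.2.2.2)) := by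
  simp only [stageLaw, supp_mix, supp_map] at hω
  obtain ⟨ω', hω', i, hi, j, hj, r, hr, rfl⟩ := hω
  exact ⟨ω', hω', i, hi, j, hj, r, hr, rfl⟩

lemma expect_belief2_stageLaw_succ (hF : IsUpdate G F) (hx : IsInitialBelief π x₀)
    (hA : IsSeenAs (stageLaw G π σ τ t) (filter1 F x₀) σ A) (φ : Belief2 K → ℝ) :
    expect (stageLaw G π σ τ (t + 1)) (fun ω => φ (belief2 (stageLaw G π σ τ (t + 1)) ω.2.2)) =
      expect (stageLaw G π σ τ t) fun ω =>
        expect (auxTransition G (belief2 (stageLaw G π σ τ t) ω.2.2) (A ω.2.2) (τ ω.2.2)) φ := by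
  let κ : History T J D → Belief2 K := fun h => match h.2 with
    | [] => belief2 (stageLaw G π σ τ t) h
    | r :: l => belief2 (auxQ G (belief2 (stageLaw G π σ τ t) (h.1, l)) (A (h.1, l))
        (τ (h.1, l))) r
  have h1 : expect (stageLaw G π σ τ (t + 1))
      (fun ω => φ (belief2 (stageLaw G π σ τ (t + 1)) ω.2.2)) =
      expect (stageLaw G π σ τ (t + 1)) fun ω => φ (κ ω.2.2) := by
    refine expect_congr fun ω hω => ?_
    obtain ⟨ω', -, i, -, j, -, r, -, hr⟩ := exists_pred_of_mem_supp_succ hω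
    have h2 : ω.2.2 = (ω'.2.2.1, (j, r.2.2) :: ω'.2.2.2) := by rw [hr]
    rw [h2, belief2_stageLaw_succ hF hx hA hω h2]
  rw [h1, expect_stageLaw_succ_auxQ hF hx hA fun h _ => φ (κ h)]
  refine expect_congr fun ω _ => ?_
  rw [auxTransition, Phi, expect_map]

/-- Three successive conditionings: the state by the filter, the action by `A`, and the belief of
player 1 by `y_t`. -/
lemma stagePayoff_eq_auxG (hF : IsUpdate G F) (hx : IsInitialBelief π x₀)
    (hA : IsSeenAs (stageLaw G π σ τ t) (filter1 F x₀) σ A) :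
    stagePayoff G π σ τ t = expect (stageLaw G π σ τ t) fun ω =>
      auxG G (belief2 (stageLaw G π σ τ t) ω.2.2) (A ω.2.2) (τ ω.2.2) := by
  refine (isCond_filter1 hF hx σ τ t fun h k => expect (σ h.1) fun i => expect (τ h.2) fun j =>
    G.g k i j).trans ?_
  refine Eq.trans (expect_congr fun ω _ => ?_)
    ((hA fun h x i => expect (τ h) fun j => expect x fun k => G.g k i j).trans
      (isCond_belief2 hF hx σ τ t fun h x => expect ((A h).1 x) fun i => expect (τ h) fun j =>
        expect x fun k => G.g k i j))
  rw [expect_comm]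
  refine expect_congr fun i _ => ?_
  rw [expect_comm]

end Step

lemma IsCond.mem_supp {α β γ : Type*} {μ : FinDist α} {f : α → β} {g : α → γ}
    {κ : γ → FinDist β} (h : IsCond μ f g κ) {a : α} (ha : a ∈ supp μ) : f a ∈ supp (κ (g a)) := by
  classical
  have h1 := (isCond_iff μ f g κ).1 h (g a) fun b => if b = f a then 1 else 0
  rw [expect_indicator] at h1
  intro h0
  rw [h0, mul_zero] at h1
  refine (expect_pos (fun ω => ?_) ha ?_).ne' h1
  · positivity
  · simp

/-! ### Beliefs at the initial stage -/

section Initial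

variable {π : FinDist (K × S × T)} {x₀ : S → FinDist K}

lemma A1a_of_isInitialBelief (hx : IsInitialBelief π x₀) : A1a π := by
  classical
  intro k c d
  have h1 := (isCond_iff π (fun ω => ω.1) (fun ω => ω.2) _).1 hx (c, d)
    fun k' => if k' = k then 1 else 0
  have h2 := (isCond_iff π (fun ω => ω.1) (fun ω => ω.2.1) _).1 (hx.coarsen (e := Prod.fst)) c
    fun k' => if k' = k then 1 else 0
  rw [expect_indicator] at h1 h2
  have e1 : π.weights (k, c, d) =
      expect π fun ω => if ω.2 = (c, d) then if ω.1 = k then 1 else 0 else 0 := by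
    rw [← expect_indicator]
    refine expect_congr fun ω _ => ?_
    obtain ⟨k', cd⟩ := ω
    have : (k', cd) = (k, c, d) ↔ k' = k ∧ cd = (c, d) := Prod.mk_inj
    simp only [this]
    split_ifs <;> first | rfl | tauto
  have e2 : (π.map fun ω => (ω.1, ω.2.1)).weights (k, c) =
      expect π fun ω => if ω.2.1 = c then if ω.1 = k then 1 else 0 else 0 := by
    rw [← expect_indicator, expect_map]
    refine expect_congr fun ω _ => ?_
    by_cases h : ω.1 = k <;> by_cases h' : ω.2.1 = c <;> simp [h, h']
  have e3 : (π.map fun ω => ω.2.1).weights c =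
      expect π fun ω => if ω.2.1 = c then 1 else 0 := by rw [← expect_indicator, expect_map]
  have e4 : (π.map fun ω => ω.2).weights (c, d) =
      expect π fun ω => if ω.2 = (c, d) then 1 else 0 := by rw [← expect_indicator, expect_map]
  rw [e1, e2, e3, e4, h1, h2]
  ring

lemma belief1_eq_of_isInitialBelief (hx : IsInitialBelief π x₀) {ω} (hω : ω ∈ supp π) :
    belief1 π ω.2.1 = x₀ ω.2.1 := by
  have h : IsCond π (fun ω => ω.1) (fun ω => ω.2.1) x₀ := hx.coarsen (e := Prod.fst)
  exact h.eq hω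

lemma belief2_eq_of_isCond (hx : IsInitialBelief π x₀) {κ : T → Belief2 K}
    (h : IsCond π (fun ω => x₀ ω.2.1) (fun ω => ω.2.2) κ) {ω} (hω : ω ∈ supp π) :
    belief2 π ω.2.2 = κ ω.2.2 := by
  have h' : IsCond π (fun ω => belief1 π ω.2.1) (fun ω => ω.2.2) κ :=
    h.congr (fun _ hω => (belief1_eq_of_isInitialBelief hx hω).symm) fun _ _ => rfl
  exact h'.eq hω

lemma belief2_stageLaw_zero {G : Game K I J C D} {F : FinDist K → I → C → FinDist K}
    (hF : IsUpdate G F) (hx : IsInitialBelief π x₀) (σ : Strategy S I C) (τ : Strategy T J D)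
    {ω} (hω : ω ∈ supp (stageLaw G π σ τ 0)) :
    belief2 (stageLaw G π σ τ 0) ω.2.2 = belief2 π ω.2.2.1 := by
  refine belief2_stageLaw_eq hF hx (κ := fun h => belief2 π h.1) (fun Ψ => ?_) hω
  simp only [stageLaw, expect_map]
  have h : IsCond π (fun ω => x₀ ω.2.1) (fun ω => ω.2.2) (belief2 π) :=
    (isCond_condLaw π (fun ω => belief1 π ω.2.1) fun ω => ω.2.2).congr
      (fun _ hω => belief1_eq_of_isInitialBelief hx hω) fun _ _ => rfl
  exact h fun d x => Ψ (d, []) x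

lemma expect_belief2_zero {G : Game K I J C D} {F : FinDist K → I → C → FinDist K}
    (hF : IsUpdate G F) (hx : IsInitialBelief π x₀) {σ : Strategy S I C} {τ : Strategy T J D}
    (φ : Belief2 K → ℝ) :
    expect (stageLaw G π σ τ 0) (fun ω => φ (belief2 (stageLaw G π σ τ 0) ω.2.2)) =
      expect π fun ω => φ (belief2 π ω.2.2) := by
  have h : expect (stageLaw G π σ τ 0) (fun ω => φ (belief2 (stageLaw G π σ τ 0) ω.2.2)) =
      expect (stageLaw G π σ τ 0) fun ω => φ (belief2 π ω.2.2.1) :=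
    expect_congr fun ω hω => by rw [belief2_stageLaw_zero hF hx σ τ hω]
  rw [h]
  simp only [stageLaw, expect_map]

end Initial

/-! ### Signal-encoded canonical games -/

section Encoded

/-- The canonical initial distribution for `z`, with the signal `p` of player 1 replaced by its
code `e p` and a constant signal of player 2. -/
def encoded (z : Belief2 K) (e : FinDist K → ℕ) : FinDist (K × ℕ × ℕ) :=
  mix z fun p => p.map fun k => (k, e p, 0)

variable {z : Belief2 K} {e : FinDist K → ℕ} {e' : ℕ → FinDist K}

/-- The assumptions concern integer signals, whereas canonical signals are beliefs; a finite support
can be coded injectively. -/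
lemma exists_encoding (z : Belief2 K) :
    ∃ (e : FinDist K → ℕ) (e' : ℕ → FinDist K), ∀ p ∈ supp z, e' (e p) = p := by
  obtain ⟨e, he⟩ := Set.countable_iff_exists_injOn.1 (supp_finite z).countable
  have : Nonempty (FinDist K) := z.nonempty
  exact ⟨e, Function.invFunOn e (supp z), fun p hp => he.leftInvOn_invFunOn hp⟩

lemma expect_encoded (f : K × ℕ × ℕ → ℝ) :
    expect (encoded z e) f = expect z fun p => expect p fun k => f (k, e p, 0) := by
  simp only [encoded, expect_mix, expect_map]

lemma isInitialBelief_encoded (he : ∀ p ∈ supp z, e' (e p) = p) :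
    IsInitialBelief (encoded z e) e' := by
  intro Ψ
  rw [expect_encoded, expect_encoded]
  exact expect_congr fun p hp => by simp only [he p hp, expect_const]

lemma mem_supp_encoded {ω : K × ℕ × ℕ} (hω : ω ∈ supp (encoded z e)) : ω.2.2 = 0 := by
  simp only [encoded, supp_mix, supp_map] at hω
  obtain ⟨p, -, k, -, rfl⟩ := hω
  rfl

lemma belief2_encoded (he : ∀ p ∈ supp z, e' (e p) = p) : belief2 (encoded z e) 0 = z := by
  obtain ⟨ω, hω⟩ := exists_mem_supp (encoded z e)
  have h := belief2_eq_of_isCond (isInitialBelief_encoded he) (κ := fun _ => z)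
    (fun Ψ => by
      rw [expect_encoded, expect_encoded]
      simp only [expect_const]
      exact expect_congr fun p hp => by rw [he p hp]) hω
  rwa [mem_supp_encoded hω] at h

lemma encoded_mem_deltaStar (he : ∀ p ∈ supp z, e' (e p) = p) : encoded z e ∈ DeltaStar K :=
  ⟨A1a_of_isInitialBelief (isInitialBelief_encoded he), fun _ => z, fun ω hω => by
    rw [mem_supp_encoded hω, belief2_encoded he]⟩

/-- The code of `p` induces the belief `p`, so the mixed action depends on the signal only through
`x₁`. -/
lemma isReduced_encoded (he : ∀ p ∈ supp z, e' (e p) = p) (a : AuxAct1 K I) :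
    IsReduced (encoded z e) (fun h : History ℕ I C => a.1 (e' h.1)) := by
  intro ω hω ω' hω' h _ l
  have hx := isInitialBelief_encoded he
  rw [belief1_eq_of_isInitialBelief hx hω, belief1_eq_of_isInitialBelief hx hω'] at h
  simp only [h]

variable {G : Game K I J C D} {F : FinDist K → I → C → FinDist K}

lemma isSeenAs_encoded (a : AuxAct1 K I) (τ : Strategy ℕ J D) :
    IsSeenAs (stageLaw G (encoded z e) (fun h => a.1 (e' h.1)) τ 0) (filter1 F e')
      (fun h => a.1 (e' h.1)) fun _ => a := by
  intro φ
  simp only [stageLaw, expect_map, filter1, List.foldr_nil]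

lemma mem_supp_stageLaw_encoded {σ : Strategy ℕ I C} {τ : Strategy ℕ J D} {ω}
    (hω : ω ∈ supp (stageLaw G (encoded z e) σ τ 0)) : ω.2.2 = (0, []) := by
  simp only [stageLaw, supp_map] at hω
  obtain ⟨ω, hω, rfl⟩ := hω
  simp [mem_supp_encoded hω]

lemma belief2_stageLaw_encoded (hF : IsUpdate G F) (he : ∀ p ∈ supp z, e' (e p) = p)
    (σ : Strategy ℕ I C) (τ : Strategy ℕ J D) :
    belief2 (stageLaw G (encoded z e) σ τ 0) (0, []) = z := by
  obtain ⟨ω, hω⟩ := exists_mem_supp (stageLaw G (encoded z e) σ τ 0)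
  have h := belief2_stageLaw_zero hF (isInitialBelief_encoded he) σ τ hω
  rwa [mem_supp_stageLaw_encoded hω, belief2_encoded he] at h

end Encoded

/-! ### The assumptions transferred to the auxiliary game -/

section Consequences

variable {G : Game K I J C D} {F : FinDist K → I → C → FinDist K}

/-- Player 2 has no influence on the law of his next second order belief. -/
lemma auxTransition_eq (hF : IsUpdate G F) (hA3 : A3 G) (z : Belief2 K) (a : AuxAct1 K I)
    (b b' : FinDist J) : auxTransition G z a b = auxTransition G z a b' := by
  obtain ⟨e, e', he⟩ := exists_encoding z
  -- In the encoded game the initial second order belief is `z`, so the law of `y₂` is the auxiliary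
  -- transition from `z`.
  have key : ∀ b : FinDist J, Phi (stageLaw G (encoded z e)
      (fun h : History ℕ I C => a.1 (e' h.1)) (fun _ : History ℕ J D => b) 1) =
        auxTransition G z a b := by
    refine fun b => finDist_ext fun φ => ?_
    rw [Phi, expect_map, expect_belief2_stageLaw_succ hF (isInitialBelief_encoded he)
      (isSeenAs_encoded a _) φ]
    refine (expect_congr fun ω hω => ?_).trans (expect_const (stageLaw G (encoded z e)
      (fun h : History ℕ I C => a.1 (e' h.1)) (fun _ : History ℕ J D => b) 0) _)
    rw [mem_supp_stageLaw_encoded hω, belief2_stageLaw_encoded hF he]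
  rw [← key, ← key]
  exact hA3 _ (encoded_mem_deltaStar he) _ (isReduced_encoded he a) _ _

lemma mem_supp_auxQ {z : Belief2 K} {a : AuxAct1 K I} {b : FinDist J} {p : FinDist K} {i : I}
    {j : J} {r : K × C × D} (hp : p ∈ supp z) (hi : i ∈ supp (a.1 p)) (hj : j ∈ supp b)
    (hr : ∃ k ∈ supp p, r ∈ supp (G.q k i j)) :
    (r.1, (p, i, r.2.1), (j, r.2.2)) ∈ supp (auxQ G z a b) := by
  obtain ⟨k, hk, hr⟩ := hr
  simp only [auxQ, supp_mix, supp_map]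
  exact ⟨p, hp, k, hk, i, hi, j, hj, r, hr, rfl⟩

/-- Changing `b` multiplies the law by a density that depends only on the action of player 2. He
knows this action, so his posterior is unchanged. This allows a single function in
`exists_belief2_auxQ_eq` to serve all `b`. -/
lemma belief2_auxQ_uniform [Fintype J] [Nonempty J] (hF : IsUpdate G F) (z : Belief2 K)
    (a : AuxAct1 K I) (b : FinDist J) {ω} (hω : ω ∈ supp (auxQ G z a b)) :
    belief2 (auxQ G z a b) ω.2.2 = belief2 (auxQ G z a (uniformDist J)) ω.2.2 := by
  refine belief2_auxQ_eq hF (fun Ψ => ?_) hω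
  have key : ∀ f : K × (FinDist K × I × C) × (J × D) → ℝ, expect (auxQ G z a b) f =
      expect (auxQ G z a (uniformDist J)) fun ω =>
        Fintype.card J * b.weights ω.2.2.1 * f ω := by
    intro f
    rw [expect_auxQ, expect_auxQ]
    refine expect_congr fun p _ => expect_congr fun i _ => ?_
    simp only [expect_const_mul]
    rw [expect_eq_sum, expect_eq_sum]
    refine Finset.sum_congr rfl fun j _ => ?_
    rw [uniformDist_weights]
    field_simp
  rw [key, key]
  simp only [← expect_const_mul]
  exact isCond_belief2_auxQ hF z a (uniformDist J) fun r x =>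
    Fintype.card J * b.weights r.1 * Ψ r x

/-- Player 1 can compute the next second order belief of player 2. -/
lemma exists_belief2_auxQ_eq [Finite J] [Nonempty J] (hF : IsUpdate G F) (hA2b : A2b G) :
    ∃ f : Belief2 K → AuxAct1 K I → FinDist K → I → C → Belief2 K, ∀ z a b,
      ∀ ω ∈ supp (auxQ G z a b),
        belief2 (auxQ G z a b) ω.2.2 = f z a ω.2.1.1 ω.2.1.2.1 ω.2.1.2.2 := by
  have := Fintype.ofFinite J
  suffices h : ∀ z a, ∃ f : FinDist K → I → C → Belief2 K, ∀ b, ∀ ω ∈ supp (auxQ G z a b),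
      belief2 (auxQ G z a b) ω.2.2 = f ω.2.1.1 ω.2.1.2.1 ω.2.1.2.2 by
    choose f hf using h
    exact ⟨f, hf⟩
  intro z a
  obtain ⟨e, e', he⟩ := exists_encoding z
  obtain ⟨f, hf⟩ := hA2b _ (encoded_mem_deltaStar he) _ (isReduced_encoded he a)
    (fun _ => uniformDist J)
  refine ⟨fun p i c => f (e p, [(i, c)]), fun b ω hω => ?_⟩
  rw [belief2_auxQ_uniform hF z a b hω]
  simp only [auxQ, supp_mix, supp_map] at hω
  obtain ⟨p, hp, k, hk, i, hi, j, hj, r, hr, rfl⟩ := hω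
  have hmem : (r.1, (e p, [(i, r.2.1)]), ((0 : ℕ), [(j, r.2.2)])) ∈
      supp (stageLaw G (encoded z e) (fun h : History ℕ I C => a.1 (e' h.1))
        (fun _ : History ℕ J D => uniformDist J) 1) := by
    simp only [stageLaw, supp_mix, supp_map]
    refine ⟨(k, (e p, []), (0, [])), ⟨(k, e p, 0), ?_, rfl⟩, i, ?_, j, (uniformDist_pos j).ne',
      r, hr, rfl⟩
    · simp only [encoded, supp_mix, supp_map]
      exact ⟨p, hp, k, hk, rfl⟩
    · simpa only [he p hp] using hi
  have h1 := belief2_stageLaw_succ hF (isInitialBelief_encoded he)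
    (isSeenAs_encoded a _) (h := (0, [])) (r := (j, r.2.2)) hmem rfl
  rw [belief2_stageLaw_encoded hF he] at h1
  exact h1.symm.trans (hf _ hmem)

end Consequences

/-! ### Strategies induced by Markov strategies -/

section Induced

/-- The second order belief of player 2, computed by player 1. -/
def filter2 (F : FinDist K → I → C → FinDist K)
    (f : Belief2 K → AuxAct1 K I → FinDist K → I → C → Belief2 K) (x₀ : S → FinDist K)
    (y₀ : S → Belief2 K) (ψ : ℕ → Belief2 K → AuxAct1 K I) (c : S) : List (I × C) → Belief2 K
  | [] => y₀ c
  | a :: l => f (filter2 F f x₀ y₀ ψ c l) (ψ l.length (filter2 F f x₀ y₀ ψ c l))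
      (filter1 F x₀ (c, l)) a.1 a.2

/-- The strategy induced by the Markov strategy `ψ`. -/
def inducedStrategy (F : FinDist K → I → C → FinDist K)
    (f : Belief2 K → AuxAct1 K I → FinDist K → I → C → Belief2 K) (x₀ : S → FinDist K)
    (y₀ : S → Belief2 K) (ψ : ℕ → Belief2 K → AuxAct1 K I) : Strategy S I C :=
  fun h => (ψ h.2.length (filter2 F f x₀ y₀ ψ h.1 h.2)).1 (filter1 F x₀ h)

variable {G : Game K I J C D} {F : FinDist K → I → C → FinDist K}
  {f : Belief2 K → AuxAct1 K I → FinDist K → I → C → Belief2 K} {π : FinDist (K × S × T)}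
  {x₀ : S → FinDist K} {y₀ : S → Belief2 K} {ψ : ℕ → Belief2 K → AuxAct1 K I}

lemma length_of_mem_supp {σ : Strategy S I C} {τ : Strategy T J D} {t : ℕ} {ω}
    (hω : ω ∈ supp (stageLaw G π σ τ t)) : ω.2.1.2.length = t ∧ ω.2.2.2.length = t := by
  induction t generalizing ω with
  | zero =>
    simp only [stageLaw, supp_map] at hω
    obtain ⟨ω, -, rfl⟩ := hω
    exact ⟨rfl, rfl⟩
  | succ t ih =>
    obtain ⟨ω', hω', i, -, j, -, r, -, rfl⟩ := exists_pred_of_mem_supp_succ hω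
    simp [ih hω']

/-- When the mixed action depends on `(y_t, x_t)` only, no averaging is needed: player 2 knows which
auxiliary action is used. -/
lemma isSeenAs_markov (hF : IsUpdate G F) (hx : IsInitialBelief π x₀) {σ : Strategy S I C}
    {τ : Strategy T J D} {t : ℕ}
    (h : ∀ ω ∈ supp (stageLaw G π σ τ t), σ ω.2.1 =
      (ψ t (belief2 (stageLaw G π σ τ t) ω.2.2)).1 (belief1 (stageLaw G π σ τ t) ω.2.1)) :
    IsSeenAs (stageLaw G π σ τ t) (filter1 F x₀) σ fun h => ψ t (belief2 (stageLaw G π σ τ t) h) := by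
  intro φ
  refine expect_congr fun ω hω => ?_
  rw [h ω hω, belief1_stageLaw hF hx σ τ t hω]

/-- Induction on the stage: if `filter2` has tracked `y_t` so far, then the auxiliary action seen by
player 2 is `ψ t y_t`, and the map `f` correctly produces `y_{t+1}` from the data of player 1. -/
lemma inducedStrategy_spec (hF : IsUpdate G F)
    (hf : ∀ z a b, ∀ ω ∈ supp (auxQ G z a b),
        belief2 (auxQ G z a b) ω.2.2 = f z a ω.2.1.1 ω.2.1.2.1 ω.2.1.2.2)
    (hx : IsInitialBelief π x₀) (hy : ∀ ω ∈ supp π, belief2 π ω.2.2 = y₀ ω.2.1)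
    (ψ : ℕ → Belief2 K → AuxAct1 K I) (τ : Strategy T J D) (t : ℕ) :
    ∀ ω ∈ supp (stageLaw G π (inducedStrategy F f x₀ y₀ ψ) τ t),
      inducedStrategy F f x₀ y₀ ψ ω.2.1 =
      (ψ t (belief2 (stageLaw G π (inducedStrategy F f x₀ y₀ ψ) τ t) ω.2.2)).1
        (belief1 (stageLaw G π (inducedStrategy F f x₀ y₀ ψ) τ t) ω.2.1) := by
  set σ := inducedStrategy F f x₀ y₀ ψ with hσ
  suffices h : ∀ ω ∈ supp (stageLaw G π σ τ t), belief2 (stageLaw G π σ τ t) ω.2.2 =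
      filter2 F f x₀ y₀ ψ ω.2.1.1 ω.2.1.2 by
    intro ω hω
    rw [h ω hω, belief1_stageLaw hF hx σ τ t hω, hσ]
    simp only [inducedStrategy, (length_of_mem_supp hω).1]
  induction t with
  | zero =>
    intro ω hω
    rw [belief2_stageLaw_zero hF hx σ τ hω]
    simp only [stageLaw, supp_map] at hω
    obtain ⟨ω, hω, rfl⟩ := hω
    exact hy ω hω
  | succ t ih =>
    intro ω hω
    obtain ⟨ω', hω', i, hi, j, hj, r, hr, rfl⟩ := exists_pred_of_mem_supp_succ hω
    have hσ' : ∀ ω ∈ supp (stageLaw G π σ τ t), σ ω.2.1 =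
        (ψ t (belief2 (stageLaw G π σ τ t) ω.2.2)).1 (filter1 F x₀ ω.2.1) := by
      intro ω hω
      rw [ih ω hω, hσ]
      simp only [inducedStrategy, (length_of_mem_supp hω).1]
    have hA := isSeenAs_markov (ψ := ψ) hF hx (σ := σ) (τ := τ) (t := t) fun ω hω => by
      rw [belief1_stageLaw hF hx σ τ t hω, hσ' ω hω]
    have h1 := belief2_stageLaw_succ hF hx hA (h := ω'.2.2) (r := (j, r.2.2)) hω rfl
    refine h1.trans ?_
    -- The formula for `f` is valid only at outcomes of positive probability, so the realized
    -- transition has to be located in the support of the one-stage law.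
    have hmem : (r.1, (filter1 F x₀ ω'.2.1, i, r.2.1), (j, r.2.2)) ∈
        supp (auxQ G (belief2 (stageLaw G π σ τ t) ω'.2.2)
          (ψ t (belief2 (stageLaw G π σ τ t) ω'.2.2)) (τ ω'.2.2)) := by
      refine mem_supp_auxQ ((isCond_belief2 hF hx σ τ t).mem_supp hω') ?_ hj
        ⟨ω'.1, (isCond_filter1 hF hx σ τ t).mem_supp hω', hr⟩
      rw [← hσ' ω' hω']
      exact hi
    refine (hf _ _ _ _ hmem).trans ?_
    simp only [filter2, (length_of_mem_supp hω').1, ih ω' hω']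

end Induced

/-! ### Payoff bounds and recursive construction of strategies of player 2 -/

section StagePayoff

variable {G : Game K I J C D} {π : FinDist (K × S × T)}

lemma stagePayoff_mem_Icc (G : Game K I J C D) (π : FinDist (K × S × T)) (σ : Strategy S I C)
    (τ : Strategy T J D) (t : ℕ) : stagePayoff G π σ τ t ∈ Set.Icc (0 : ℝ) 1 :=
  ⟨le_expect_of_le fun _ _ => le_expect_of_le fun _ _ => le_expect_of_le fun _ _ =>
      (G.g_mem _ _ _).1,
    expect_le_of_le fun _ _ => expect_le_of_le fun _ _ => expect_le_of_le fun _ _ =>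
      (G.g_mem _ _ _).2⟩

lemma avgPayoff_mem_Icc (G : Game K I J C D) (π : FinDist (K × S × T)) (σ : Strategy S I C)
    (τ : Strategy T J D) (m n : ℕ) : avgPayoff G π σ τ m n ∈ Set.Icc (0 : ℝ) 1 := by
  constructor
  · exact div_nonneg (Finset.sum_nonneg fun t _ => (stagePayoff_mem_Icc G π σ τ _).1)
      (Nat.cast_nonneg n)
  · refine div_le_one_of_le₀ ?_ (Nat.cast_nonneg n)
    refine (Finset.sum_le_sum fun t _ => (stagePayoff_mem_Icc G π σ τ (m + t)).2).trans ?_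
    simp

/-- The law at a stage depends only on the behavior of player 2 at the earlier stages. -/
lemma stageLaw_congr {σ : Strategy S I C} {τ τ' : Strategy T J D} {t : ℕ}
    (h : ∀ h : History T J D, h.2.length < t → τ h = τ' h) :
    stageLaw G π σ τ t = stageLaw G π σ τ' t := by
  induction t with
  | zero => rfl
  | succ t ih =>
    rw [stageLaw, stageLaw, ih fun h' hh => h h' (by omega)]
    refine mix_congr fun ω hω => mix_congr fun i _ => ?_
    rw [h ω.2.2 (by rw [(length_of_mem_supp hω).2]; omega)]

lemma stagePayoff_congr {σ : Strategy S I C} {τ τ' : Strategy T J D} {t : ℕ}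
    (h : ∀ h : History T J D, h.2.length ≤ t → τ h = τ' h) :
    stagePayoff G π σ τ t = stagePayoff G π σ τ' t := by
  rw [stagePayoff, stagePayoff, stageLaw_congr fun h' hh => h h' hh.le]
  refine expect_congr fun ω hω => ?_
  rw [h ω.2.2 (length_of_mem_supp hω).2.le]

/-- Strategies of player 2 can be defined by recursion on the stage, using the law induced by the
behavior at the previous stages. -/
lemma exists_recursive_strategy (G : Game K I J C D) (π : FinDist (K × S × T))
    (σ : Strategy S I C) (τ₀ : Strategy T J D) (m : ℕ)
    (R : ℕ → FinDist (K × History S I C × History T J D) → History T J D → FinDist J) :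
    ∃ τ : Strategy T J D, (∀ h : History T J D, h.2.length < m → τ h = τ₀ h) ∧
      ∀ h : History T J D, m ≤ h.2.length →
        τ h = R h.2.length (stageLaw G π σ τ h.2.length) h := by
  classical
  -- `U n` is final on histories of length less than `n`: step `t + 1` overwrites length `t` only,
  -- using a law that depends on shorter histories only.
  let U : ℕ → Strategy T J D := fun n => Nat.rec τ₀ (fun t τ h =>
    if m ≤ t ∧ h.2.length = t then R t (stageLaw G π σ τ t) h else τ h) n
  have hU : ∀ t h, U (t + 1) h =
      if m ≤ t ∧ h.2.length = t then R t (stageLaw G π σ (U t) t) h else U t h := fun _ _ => rfl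
  have h1 : ∀ h n, h.2.length < n → U n h = U (h.2.length + 1) h := by
    intro h n hn
    induction n, hn using Nat.le_induction with
    | base => rfl
    | succ n hn ih => rw [hU, if_neg (by omega), ih]
  have h2 : ∀ h, h.2.length < m → ∀ n, U n h = τ₀ h := by
    intro h hm n
    induction n with
    | zero => rfl
    | succ n ih => rw [hU, if_neg (by omega), ih]
  refine ⟨fun h => U (h.2.length + 1) h, fun h hm => h2 h hm (h.2.length + 1), fun h hm => ?_⟩
  change U (h.2.length + 1) h = _
  rw [hU, if_pos ⟨hm, rfl⟩]
  congr 1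
  exact stageLaw_congr fun h' hh => h1 h' _ hh

end StagePayoff

/-! ### Worst payoffs in the auxiliary game -/

section GMin

/-- Affinity in `b` is why the minimum over pure actions in `gMin` is also the minimum over mixed
ones. -/
lemma auxG_eq_expect (G : Game K I J C D) (z : Belief2 K) (a : AuxAct1 K I) (b : FinDist J) :
    auxG G z a b = expect b fun j => auxG G z a (StdSimplex.single j) := by
  simp only [auxG, expect_single]
  rw [← expect_comm]
  exact expect_congr fun p _ => by rw [← expect_comm]

lemma auxG_mem_Icc (G : Game K I J C D) (z : Belief2 K) (a : AuxAct1 K I) (b : FinDist J) :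
    auxG G z a b ∈ Set.Icc (0 : ℝ) 1 :=
  ⟨le_expect_of_le fun _ _ => le_expect_of_le fun _ _ => le_expect_of_le fun _ _ =>
      le_expect_of_le fun _ _ => (G.g_mem _ _ _).1,
    expect_le_of_le fun _ _ => expect_le_of_le fun _ _ => expect_le_of_le fun _ _ =>
      expect_le_of_le fun _ _ => (G.g_mem _ _ _).2⟩

/-- The payoff of the action `a` in the state `z` against a best reply. -/
def gMin (G : Game K I J C D) (z : Belief2 K) (a : AuxAct1 K I) : ℝ :=
  ⨅ j, auxG G z a (StdSimplex.single j)

lemma gMin_le_auxG [Finite J] (G : Game K I J C D) (z : Belief2 K) (a : AuxAct1 K I) (b : FinDist J) :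
    gMin G z a ≤ auxG G z a b := by
  rw [auxG_eq_expect]
  exact le_expect_of_le fun j _ => ciInf_le (Set.finite_range _).bddBelow j

variable [Finite J] [Nonempty J]

lemma exists_auxG_eq_gMin (G : Game K I J C D) (z : Belief2 K) (a : AuxAct1 K I) :
    ∃ b, auxG G z a b = gMin G z a := by
  obtain ⟨j, hj⟩ := exists_eq_ciInf_of_finite (f := fun j => auxG G z a (StdSimplex.single j))
  exact ⟨_, hj⟩

lemma gMin_mem_Icc (G : Game K I J C D) (z : Belief2 K) (a : AuxAct1 K I) :
    gMin G z a ∈ Set.Icc (0 : ℝ) 1 := by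
  obtain ⟨b, hb⟩ := exists_auxG_eq_gMin G z a
  rw [← hb]
  exact auxG_mem_Icc G z a b

/-- Player 2 can play a best reply at all stages from stage `m + 1` on, whatever he does before. -/
lemma exists_bestReply (G : Game K I J C D) (π : FinDist (K × S × T)) (σ : Strategy S I C)
    (τ₀ : Strategy T J D) (m : ℕ)
    (A : ℕ → FinDist (K × History S I C × History T J D) → History T J D → AuxAct1 K I) :
    ∃ τ : Strategy T J D, (∀ h : History T J D, h.2.length < m → τ h = τ₀ h) ∧
      ∀ t, m ≤ t → ∀ ω ∈ supp (stageLaw G π σ τ t),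
        auxG G (belief2 (stageLaw G π σ τ t) ω.2.2) (A t (stageLaw G π σ τ t) ω.2.2) (τ ω.2.2) =
          gMin G (belief2 (stageLaw G π σ τ t) ω.2.2) (A t (stageLaw G π σ τ t) ω.2.2) := by
  obtain ⟨τ, h1, h2⟩ := exists_recursive_strategy G π σ τ₀ m fun t μ h =>
    (exists_auxG_eq_gMin G (belief2 μ h) (A t μ h)).choose
  refine ⟨τ, h1, fun t ht ω hω => ?_⟩
  have hl := (length_of_mem_supp hω).2
  rw [h2 ω.2.2 (hl ▸ ht), hl]
  exact (exists_auxG_eq_gMin G (belief2 (stageLaw G π σ τ t) ω.2.2)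
    (A t (stageLaw G π σ τ t) ω.2.2)).choose_spec

end GMin

/-! ### Dynamic programming -/

instance [Nonempty I] : Nonempty (AuxAct1 K I) :=
  ⟨⟨fun _ => StdSimplex.single (Classical.arbitrary I), measurable_const⟩⟩

/-- The value function of player 1 in the auxiliary game when `r` stages remain, only the payoffs
of the last `n` stages count, and player 2 plays a best reply in these. The action `b` of player 2
in the transition is immaterial. -/
def dp (G : Game K I J C D) (b : FinDist J) (n : ℕ) : ℕ → Belief2 K → ℝ
  | 0, _ => 0
  | r + 1, z => ⨆ a : AuxAct1 K I,
      (if r < n then gMin G z a else 0) + expect (auxTransition G z a b) (dp G b n r)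

section DP

lemma exists_dp_succ_le [Nonempty I] (G : Game K I J C D) (b : FinDist J) (n r : ℕ) (z : Belief2 K) {ε : ℝ}
    (hε : 0 < ε) : ∃ a : AuxAct1 K I, dp G b n (r + 1) z ≤
      (if r < n then gMin G z a else 0) + expect (auxTransition G z a b) (dp G b n r) + ε := by
  obtain ⟨a, ha⟩ := exists_lt_of_lt_ciSup (sub_lt_self (dp G b n (r + 1) z) hε)
  exact ⟨a, by linarith⟩

variable [Finite J] [Nonempty J] [Nonempty I]

/-- This bound makes the supremum in `dp` a genuine one; `le_dp_succ` relies on it. -/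
lemma dp_le (G : Game K I J C D) (b : FinDist J) (n r : ℕ) (z : Belief2 K) :
    dp G b n r z ≤ r := by
  induction r generalizing z with
  | zero => simp [dp]
  | succ r ih =>
    refine ciSup_le fun a => ?_
    have h1 : (if r < n then gMin G z a else 0) ≤ 1 := by
      split_ifs
      exacts [(gMin_mem_Icc G z a).2, zero_le_one]
    have h2 := expect_le_of_le (μ := auxTransition G z a b) fun z' _ => ih z'
    push_cast
    linarith

lemma le_dp_succ (G : Game K I J C D) (b : FinDist J) (n r : ℕ) (z : Belief2 K)
    (a : AuxAct1 K I) : (if r < n then gMin G z a else 0) +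
      expect (auxTransition G z a b) (dp G b n r) ≤ dp G b n (r + 1) z := by
  refine le_ciSup (f := fun a => (if r < n then gMin G z a else 0) +
      expect (auxTransition G z a b) (dp G b n r)) ⟨1 + r, ?_⟩ a
  rintro _ ⟨a, rfl⟩
  have h1 : (if r < n then gMin G z a else 0) ≤ 1 := by
    split_ifs
    exacts [(gMin_mem_Icc G z a).2, zero_le_one]
  exact add_le_add h1 (expect_le_of_le fun z' _ => dp_le G b n r z')

variable {G : Game K I J C D} {F : FinDist K → I → C → FinDist K} {π : FinDist (K × S × T)}
  {x₀ : S → FinDist K} {σ : Strategy S I C} {τ : Strategy T J D} {t : ℕ}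
  {A : History T J D → AuxAct1 K I}

/-- Whatever player 1 does, the expected value function decreases by at least the stage payoff
against a best reply. -/
lemma gMin_add_expect_dp_le (hF : IsUpdate G F) (hA3 : A3 G) (hx : IsInitialBelief π x₀)
    (hA : IsSeenAs (stageLaw G π σ τ t) (filter1 F x₀) σ A) (b : FinDist J) (n r : ℕ) :
    expect (stageLaw G π σ τ t) (fun ω =>
        if r < n then gMin G (belief2 (stageLaw G π σ τ t) ω.2.2) (A ω.2.2) else 0) +
      expect (stageLaw G π σ τ (t + 1))
        (fun ω => dp G b n r (belief2 (stageLaw G π σ τ (t + 1)) ω.2.2)) ≤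
      expect (stageLaw G π σ τ t)
        fun ω => dp G b n (r + 1) (belief2 (stageLaw G π σ τ t) ω.2.2) := by
  rw [expect_belief2_stageLaw_succ hF hx hA (dp G b n r), ← expect_add]
  refine expect_mono fun ω _ => ?_
  rw [auxTransition_eq hF hA3 _ _ _ b]
  exact le_dp_succ G b n r _ _

/-- Player 2 can hold the payoff of stages `m + 1, …, m + n` down to the value function against a
given strategy of player 1, whatever he does before stage `m + 1`. -/
lemma exists_reply_sum_le_dp [Finite K] (hF : IsUpdate G F) (hA3 : A3 G)
    (hx : IsInitialBelief π x₀) (b : FinDist J) (σ : Strategy S I C) (τ₀ : Strategy T J D)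
    (m n : ℕ) :
    ∃ τ : Strategy T J D, (∀ h : History T J D, h.2.length < m → τ h = τ₀ h) ∧
      ∑ u ∈ Finset.range n, stagePayoff G π σ τ (m + u) ≤
        expect π fun ω => dp G b n (m + n) (belief2 π ω.2.2) := by
  obtain ⟨τ, h1, h2⟩ := exists_bestReply G π σ τ₀ m
    fun _ μ => (exists_isSeenAs μ (filter1 F x₀) σ).choose
  refine ⟨τ, h1, ?_⟩
  have hA : ∀ t, IsSeenAs (stageLaw G π σ τ t) (filter1 F x₀) σ
      (exists_isSeenAs (stageLaw G π σ τ t) (filter1 F x₀) σ).choose :=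
    fun t => (exists_isSeenAs (stageLaw G π σ τ t) (filter1 F x₀) σ).choose_spec
  let E : ℕ → ℕ → ℝ := fun t r => expect (stageLaw G π σ τ t)
    fun ω => dp G b n r (belief2 (stageLaw G π σ τ t) ω.2.2)
  -- Used before the block: the value function cannot increase in expectation, because the dropped
  -- term is nonnegative.
  have hE1 : ∀ t r, E (t + 1) r ≤ E t (r + 1) := by
    intro t r
    have h3 := gMin_add_expect_dp_le hF hA3 hx (hA t) b n r
    refine le_trans (le_add_of_nonneg_left (le_expect_of_le fun ω _ => ?_)) h3
    split_ifs
    exacts [(gMin_mem_Icc G _ _).1, le_rfl]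
  have hE2 : ∀ t r, m ≤ t → r < n → stagePayoff G π σ τ t + E (t + 1) r ≤ E t (r + 1) := by
    intro t r ht hr
    have h3 := gMin_add_expect_dp_le hF hA3 hx (hA t) b n r
    simp only [hr, if_true] at h3
    rw [stagePayoff_eq_auxG hF hx (hA t), expect_congr (h2 t ht)]
    exact h3
  -- Telescoping inside the block; at its end no stage remains and the value function is zero.
  have h3 : ∀ s ≤ n, ∑ u ∈ Finset.range s, stagePayoff G π σ τ (m + u) + E (m + s) (n - s) ≤
      E m n := by
    intro s
    induction s with
    | zero => simp
    | succ s ih =>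
      intro hs
      have h4 := hE2 (m + s) (n - (s + 1)) (by omega) (by omega)
      rw [show n - (s + 1) + 1 = n - s by omega] at h4
      have h5 := ih (by omega)
      rw [Finset.sum_range_succ, ← add_assoc m s 1]
      linarith
  have h4 : ∀ s, E s n ≤ E 0 (s + n) := by
    have : ∀ s r, E s r ≤ E 0 (s + r) := by
      intro s
      induction s with
      | zero => intro r; rw [Nat.zero_add]
      | succ s ih =>
        intro r
        refine (hE1 s r).trans ((ih (r + 1)).trans_eq ?_)
        rw [show s + (r + 1) = s + 1 + r by omega]
    exact fun s => this s n
  have h5 := h3 n le_rfl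
  have h6 : E (m + n) (n - n) = 0 := by
    rw [Nat.sub_self]
    exact expect_const _ 0
  have h7 : E 0 (m + n) = _ := expect_belief2_zero hF hx (dp G b n (m + n))
  linarith [h4 m]

omit [Nonempty J] in
/-- Player 1 can secure the value function up to `ε` with a strategy induced by a Markov
strategy. -/
lemma exists_dp_le_sum {f : Belief2 K → AuxAct1 K I → FinDist K → I → C → Belief2 K}
    {y₀ : S → Belief2 K} (hF : IsUpdate G F) (hA3 : A3 G)
    (hf : ∀ z a b, ∀ ω ∈ supp (auxQ G z a b),
        belief2 (auxQ G z a b) ω.2.2 = f z a ω.2.1.1 ω.2.1.2.1 ω.2.1.2.2)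
    (hx : IsInitialBelief π x₀) (hy : ∀ ω ∈ supp π, belief2 π ω.2.2 = y₀ ω.2.1)
    (b : FinDist J) (m n : ℕ) {ε : ℝ} (hε : 0 < ε) :
    ∃ σ : Strategy S I C, ∀ τ : Strategy T J D,
      expect π (fun ω => dp G b n (m + n) (belief2 π ω.2.2)) ≤
        ∑ u ∈ Finset.range n, stagePayoff G π σ τ (m + u) + (m + n) * ε := by
  -- At index `t`, `m + n - (t + 1)` stages remain after the current one; each choice loses at most
  -- `ε`.
  choose ψ hψ using fun (t : ℕ) (z : Belief2 K) =>
    exists_dp_succ_le G b n (m + n - (t + 1)) z hε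
  refine ⟨inducedStrategy F f x₀ y₀ ψ, fun τ => ?_⟩
  set σ := inducedStrategy F f x₀ y₀ ψ with hσ
  have hA : ∀ t, IsSeenAs (stageLaw G π σ τ t) (filter1 F x₀) σ
      fun h => ψ t (belief2 (stageLaw G π σ τ t) h) := fun t =>
    isSeenAs_markov hF hx (inducedStrategy_spec hF hf hx hy ψ τ t)
  let E : ℕ → ℕ → ℝ := fun t r => expect (stageLaw G π σ τ t)
    fun ω => dp G b n r (belief2 (stageLaw G π σ τ t) ω.2.2)
  have hE : ∀ t < m + n, E t (m + n - t) ≤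
      (if m ≤ t then stagePayoff G π σ τ t else 0) + E (t + 1) (m + n - (t + 1)) + ε := by
    intro t ht
    have h1 : E t (m + n - t) = expect (stageLaw G π σ τ t) fun ω =>
        dp G b n (m + n - (t + 1) + 1) (belief2 (stageLaw G π σ τ t) ω.2.2) := by
      rw [show m + n - (t + 1) + 1 = m + n - t by omega]
    rw [h1]
    refine (expect_mono fun ω _ => hψ t _).trans ?_
    rw [expect_add, expect_add, expect_const]
    refine add_le_add (add_le_add ?_ (le_of_eq ?_)) le_rfl
    -- For `t < m + n`, index `t` lies in the block exactly when fewer than `n` stages remain after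
    -- it.
    · by_cases hm : m ≤ t
      · simp only [hm, if_true, show m + n - (t + 1) < n by omega]
        rw [stagePayoff_eq_auxG hF hx (hA t)]
        exact expect_mono fun ω _ => gMin_le_auxG G _ _ _
      · simp only [hm, if_false, show ¬ (m + n - (t + 1) < n) by omega, expect_const, le_refl]
    · refine Eq.trans (expect_congr fun ω _ => ?_)
        (expect_belief2_stageLaw_succ hF hx (hA t) _).symm
      rw [auxTransition_eq hF hA3 _ _ b (τ ω.2.2)]
  have h1 : ∀ s ≤ m + n, E 0 (m + n) ≤
      ∑ t ∈ Finset.range s, (if m ≤ t then stagePayoff G π σ τ t else 0) +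
        E s (m + n - s) + s * ε := by
    intro s
    induction s with
    | zero => simp
    | succ s ih =>
      intro hs
      have h2 := ih (by omega)
      have h3 := hE s (by omega)
      rw [Finset.sum_range_succ]
      push_cast
      linarith
  have h2 := h1 (m + n) le_rfl
  have h3 : E (m + n) (m + n - (m + n)) = 0 := by
    rw [Nat.sub_self]
    exact expect_const _ 0
  have h4 : ∑ t ∈ Finset.range (m + n), (if m ≤ t then stagePayoff G π σ τ t else 0) =
      ∑ u ∈ Finset.range n, stagePayoff G π σ τ (m + u) := by
    rw [Finset.sum_range_add, Finset.sum_eq_zero, zero_add]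
    · exact Finset.sum_congr rfl fun u _ => if_pos (by omega)
    · intro t ht
      exact if_neg (by simpa using ht)
  have h5 : E 0 (m + n) = _ := expect_belief2_zero hF hx (dp G b n (m + n))
  rw [h3, h4, h5] at h2
  push_cast at h2
  linarith

omit [Nonempty J] in
-- The near-optimal strategy from `exists_dp_le_sum` competes in the supremum defining `value`, and
-- its total error is arbitrarily small.
lemma expect_dp_le_value [Finite K] {f : Belief2 K → AuxAct1 K I → FinDist K → I → C → Belief2 K}
    {y₀ : S → Belief2 K} (hF : IsUpdate G F) (hA3 : A3 G)
    (hf : ∀ z a b, ∀ ω ∈ supp (auxQ G z a b),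
        belief2 (auxQ G z a b) ω.2.2 = f z a ω.2.1.1 ω.2.1.2.1 ω.2.1.2.2)
    (hx : IsInitialBelief π x₀) (hy : ∀ ω ∈ supp π, belief2 π ω.2.2 = y₀ ω.2.1)
    (b : FinDist J) (m n : ℕ) (hn : 0 < n) :
    expect π (fun ω => dp G b n (m + n) (belief2 π ω.2.2)) ≤ n * value G π m n := by
  have hn' : (0 : ℝ) < n := Nat.cast_pos.2 hn
  have : Nonempty (Strategy T J D) := ⟨fun _ => b⟩
  refine le_of_forall_pos_le_add fun δ hδ => ?_
  obtain ⟨σ, hσ⟩ := exists_dp_le_sum hF hA3 hf hx hy b m n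
    (ε := δ / (m + n)) (by positivity)
  have h1 : (expect π (fun ω => dp G b n (m + n) (belief2 π ω.2.2)) - δ) / n ≤
      ⨅ τ : Strategy T J D, avgPayoff G π σ τ m n := by
    refine le_ciInf fun τ => ?_
    have h2 := hσ τ
    rw [mul_div_cancel₀ _ (by positivity)] at h2
    exact div_le_div_of_nonneg_right (by linarith) hn'.le
  have h2 : ⨅ τ : Strategy T J D, avgPayoff G π σ τ m n ≤ value G π m n := by
    refine le_ciSup (f := fun σ => ⨅ τ : Strategy T J D, avgPayoff G π σ τ m n) ⟨1, ?_⟩ σ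
    rintro _ ⟨σ, rfl⟩
    refine (ciInf_le ⟨0, ?_⟩ (fun _ => b)).trans (avgPayoff_mem_Icc G π σ _ m n).2
    rintro _ ⟨τ, rfl⟩
    exact (avgPayoff_mem_Icc G π σ τ m n).1
  have h3 := h1.trans h2
  rw [div_le_iff₀ hn'] at h3
  linarith

end DP

/-! ### A minimax theorem -/

section Minimax

/-- A minimax theorem for functions that are convexlike in both variables and continuous in the
second one, which ranges over a compact space. -/
theorem exists_forall_le_of_forall_exists_le {X Y : Type*} [TopologicalSpace Y] [CompactSpace Y]
    [Nonempty Y] {γ : X → Y → ℝ} (hγ : ∀ x, Continuous (γ x))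
    (hX : ∀ x x' (s t : ℝ), 0 ≤ s → 0 ≤ t → s + t = 1 →
      ∃ x'', ∀ y, γ x'' y = s * γ x y + t * γ x' y)
    (hY : ∀ y y' (s t : ℝ), 0 ≤ s → 0 ≤ t → s + t = 1 →
      ∃ y'', ∀ x, γ x y'' = s * γ x y + t * γ x y')
    {v ε : ℝ} (hε : 0 < ε) (h : ∀ x, ∃ y, γ x y ≤ v) : ∃ y, ∀ x, γ x y ≤ v + ε := by
  classical
  -- Sublevel sets are closed, so by compactness finitely many `x` suffice.
  suffices hfin : ∀ s : Finset X, ∃ y, ∀ x ∈ s, γ x y ≤ v + ε by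
    obtain ⟨y, hy⟩ := CompactSpace.iInter_nonempty (t := fun x => {y | γ x y ≤ v + ε})
      (fun x => isClosed_le (hγ x) continuous_const) fun s => by
        obtain ⟨y, hy⟩ := hfin s
        exact ⟨y, Set.mem_iInter₂.2 hy⟩
    exact ⟨y, fun x => Set.mem_iInter.1 hy x⟩
  intro s
  by_contra! hs
  let Lo : Set (s → ℝ) := Set.univ.pi fun _ => Set.Iio (v + ε)
  let P : Set (s → ℝ) := Set.range fun y x => γ x y
  have hLo : Convex ℝ Lo := convex_pi fun _ _ => convex_Iio _
  have hLo' : IsOpen Lo := isOpen_set_pi Set.finite_univ fun _ _ => isOpen_Iio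
  have hP : Convex ℝ P := by
    rintro _ ⟨y, rfl⟩ _ ⟨y', rfl⟩ a b ha hb hab
    obtain ⟨y'', hy⟩ := hY y y' a b ha hb hab
    exact ⟨y'', funext fun x => by simp [hy]⟩
  have hdisj : Disjoint Lo P := by
    rw [Set.disjoint_left]
    rintro _ hlo ⟨y, rfl⟩
    obtain ⟨x, hx, hxy⟩ := hs y
    exact absurd (hlo ⟨x, hx⟩ trivial) (not_lt.2 hxy.le)
  -- If every `y` fails, the convex set of payoff vectors misses the open orthant below `v + ε`;
  -- separate the two.
  obtain ⟨f, u, hf1, hf2⟩ := geometric_hahn_banach_open hLo hLo' hP hdisj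
  let w : s → ℝ := fun x => f (Pi.single x 1)
  have hfw : ∀ p : s → ℝ, f p = ∑ x, w x * p x := by
    intro p
    conv_lhs => rw [← Finset.univ_sum_single p]
    rw [map_sum]
    refine Finset.sum_congr rfl fun x _ => ?_
    have : (Pi.single x (p x) : s → ℝ) = p x • Pi.single x 1 := by
      rw [← Pi.single_smul, smul_eq_mul, mul_one]
    rw [this, map_smul, smul_eq_mul, mul_comm]
  have hlow : ∀ p : s → ℝ, (∀ x, p x < v + ε) → f p < u := fun p hp =>
    hf1 p fun x _ => hp x
  -- The orthant is unbounded below in each coordinate, so a negative weight would violate the bound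
  -- by `u`.
  have hw : ∀ x, 0 ≤ w x := by
    intro x
    by_contra! hx
    let p : ℝ → s → ℝ := fun r => (fun _ => v) - r • Pi.single x 1
    have h1 : ∀ r : ℝ, 0 ≤ r → f (fun _ => v) - r * w x < u := by
      intro r hr
      have h2 := hlow (p r) fun x' => by
        have : (0 : ℝ) ≤ r * (Pi.single x 1 : s → ℝ) x' :=
          mul_nonneg hr (by by_cases h : x' = x <;> simp [h])
        simp only [p, Pi.sub_apply, Pi.smul_apply, smul_eq_mul]
        linarith
      simpa only [p, map_sub, map_smul, smul_eq_mul] using h2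
    have h3 := h1 ((u - f fun _ => v) / (-w x))
      (div_nonneg (by linarith [hlow (fun _ => v) fun _ => by linarith]) (by linarith))
    have h4 : (u - f fun _ => v) / (-w x) * w x = -(u - f fun _ => v) := by
      field_simp [hx.ne]
    linarith
  have hW0 : 0 ≤ ∑ x, w x := Finset.sum_nonneg fun x _ => hw x
  have hconst : ∀ r : ℝ, f (fun _ => r) = (∑ x, w x) * r := fun r => by
    rw [hfw, Finset.sum_mul]
  obtain ⟨y₀⟩ := ‹Nonempty Y›
  have hW : 0 < ∑ x, w x := by
    refine lt_of_le_of_ne hW0 fun hW => ?_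
    have h0 : ∀ x, w x = 0 := fun x =>
      (Finset.sum_eq_zero_iff_of_nonneg fun x _ => hw x).1 hW.symm x (Finset.mem_univ x)
    have h1 := hlow (fun _ => v) fun _ => by linarith
    have h2 := hf2 _ ⟨y₀, rfl⟩
    simp only [hfw, h0, zero_mul, Finset.sum_const_zero] at h1 h2
    linarith
  have hu : (∑ x, w x) * (v + ε / 2) ≤ u := by
    rw [← hconst]
    exact (hlow _ fun _ => by linarith).le
  have hM : Convex ℝ (Set.range γ) := by
    rintro _ ⟨x, rfl⟩ _ ⟨x', rfl⟩ a b ha hb hab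
    obtain ⟨x'', hx⟩ := hX x x' a b ha hb hab
    exact ⟨x'', funext fun y => by simp [hx]⟩
  -- The normalized weights are realized by a single `x`, whose reply of value at most `v`
  -- contradicts the lower bound `v + ε / 2`.
  obtain ⟨x, hx⟩ := hM.sum_mem (t := Finset.univ) (w := fun x : s => w x / ∑ x, w x)
    (z := fun x => γ x) (fun x _ => div_nonneg (hw x) hW0)
    (by rw [← Finset.sum_div, div_self hW.ne']) fun x _ => ⟨x, rfl⟩
  obtain ⟨y, hy⟩ := h x
  rw [hx] at hy
  have h1 : (∑ x, w x) * (v + ε / 2) ≤ ∑ x : s, w x * γ x y := by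
    rw [← hfw]
    exact hu.trans (hf2 _ ⟨y, rfl⟩)
  have h2 : (∑ i : s, (w i / ∑ x, w x) • γ i) y = (∑ x : s, w x * γ x y) / ∑ x, w x := by
    rw [Finset.sum_apply, Finset.sum_div]
    exact Finset.sum_congr rfl fun i _ => by
      rw [Pi.smul_apply, smul_eq_mul, div_mul_eq_mul_div]
  rw [h2, div_le_iff₀ hW] at hy
  nlinarith

end Minimax

/-! ### Likelihoods and mixtures of behavior strategies -/

section Likelihood

variable {A O : Type*} [Fintype A]

/-- The likelihood, with respect to uniform behavior, of the past actions of a player. -/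
def likelihood (σ : Strategy S A O) (s : S) : List (A × O) → ℝ
  | [] => 1
  | a :: l => Fintype.card A * (σ (s, l)).weights a.1 * likelihood σ s l

/-- The likelihood, with respect to uniform behavior, of the past actions and the next action. -/
def nextLikelihood (σ : Strategy S A O) (h : History S A O) (a : A) : ℝ :=
  Fintype.card A * (σ h).weights a * likelihood σ h.1 h.2

lemma likelihood_nonneg (σ : Strategy S A O) (s : S) (l : List (A × O)) :
    0 ≤ likelihood σ s l := by
  induction l with
  | nil => exact zero_le_one
  | cons a l ih =>
    exact mul_nonneg (mul_nonneg (Nat.cast_nonneg _) (StdSimplex.weights_nonneg _)) ih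

/-- Mixtures of behavior strategies are realized by behavior strategies. -/
lemma exists_mixture (σ σ' : Strategy S A O) {p q : ℝ} (hp : 0 ≤ p) (hq : 0 ≤ q)
    (hpq : p + q = 1) : ∃ ρ : Strategy S A O, (∀ h, σ h = σ' h → ρ h = σ h) ∧
      ∀ h a, nextLikelihood ρ h a = p * nextLikelihood σ h a + q * nextLikelihood σ' h a := by
  classical
  let W : History S A O → ℝ := fun h => p * likelihood σ h.1 h.2 + q * likelihood σ' h.1 h.2
  have h1 : ∀ h : History S A O, 0 ≤ p * likelihood σ h.1 h.2 := fun h =>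
    mul_nonneg hp (likelihood_nonneg _ _ _)
  have h2 : ∀ h : History S A O, 0 ≤ q * likelihood σ' h.1 h.2 := fun h =>
    mul_nonneg hq (likelihood_nonneg _ _ _)
  have hW : ∀ h, 0 ≤ W h := fun h => add_nonneg (h1 h) (h2 h)
  -- Bayesian weights of the two strategies given the past. Where both have zero weight the choice
  -- is free, and taking `σ h` preserves agreement with a common value.
  let ρ : Strategy S A O := fun h => if hh : W h = 0 then σ h else
    convexCombPair (p * likelihood σ h.1 h.2 / W h) (q * likelihood σ' h.1 h.2 / W h)
      (div_nonneg (h1 h) (hW h)) (div_nonneg (h2 h) (hW h))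
      (by rw [← add_div]; exact div_self hh) (σ h) (σ' h)
  have key : ∀ h : History S A O, likelihood ρ h.1 h.2 = W h → ∀ a,
      nextLikelihood ρ h a = p * nextLikelihood σ h a + q * nextLikelihood σ' h a := by
    intro h hρ a
    rw [nextLikelihood, hρ]
    by_cases hh : W h = 0
    · have h3 : p * likelihood σ h.1 h.2 = 0 := by
        have : p * likelihood σ h.1 h.2 + q * likelihood σ' h.1 h.2 = 0 := hh
        linarith [h1 h, h2 h]
      have h4 : q * likelihood σ' h.1 h.2 = 0 := by
        have : p * likelihood σ h.1 h.2 + q * likelihood σ' h.1 h.2 = 0 := hh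
        linarith [h1 h, h2 h]
      rw [hh, nextLikelihood, nextLikelihood]
      linear_combination (-(Fintype.card A * (σ h).weights a)) * h3
        - (Fintype.card A * (σ' h).weights a) * h4
    · simp only [ρ, dif_neg hh, StdSimplex.weights_convexCombPair, Finsupp.add_apply,
        Finsupp.smul_apply, smul_eq_mul, nextLikelihood]
      field_simp
  have hρ : ∀ s l, likelihood ρ s l = W (s, l) := by
    intro s l
    induction l with
    | nil => simp [likelihood, W, hpq]
    | cons a l ih => exact key (s, l) ih a.1
  refine ⟨ρ, fun h hh => ?_, fun h => key h (hρ h.1 h.2)⟩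
  by_cases h0 : W h = 0
  · simp only [ρ, dif_pos h0]
  · simp only [ρ, dif_neg h0, ← hh, convexCombPair_same]

variable [Fintype I] [Nonempty I] [Fintype J] [Nonempty J]

lemma expect_eq_expect_uniformDist {α : Type*} [Fintype α] [Nonempty α] (μ : FinDist α)
    (f : α → ℝ) :
    expect μ f = expect (uniformDist α) fun a => Fintype.card α * μ.weights a * f a := by
  rw [expect_eq_sum, expect_eq_sum]
  refine Finset.sum_congr rfl fun a _ => ?_
  rw [uniformDist_weights]
  field_simp

/-- The law of the histories under uniform behavior. -/
def refLaw (G : Game K I J C D) (π : FinDist (K × S × T)) (t : ℕ) :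
    FinDist (K × History S I C × History T J D) :=
  stageLaw G π (fun _ => uniformDist I) (fun _ => uniformDist J) t

/-- The density with respect to uniform play is a product of one likelihood per player. Payoffs are
therefore bilinear in the likelihoods, which is what the minimax argument needs. -/
lemma expect_stageLaw_eq_refLaw (G : Game K I J C D) (π : FinDist (K × S × T))
    (σ : Strategy S I C) (τ : Strategy T J D) (t : ℕ)
    (f : K × History S I C × History T J D → ℝ) :
    expect (stageLaw G π σ τ t) f = expect (refLaw G π t) fun ω =>
      likelihood σ ω.2.1.1 ω.2.1.2 * likelihood τ ω.2.2.1 ω.2.2.2 * f ω := by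
  induction t generalizing f with
  | zero => simp only [refLaw, stageLaw, expect_map, likelihood, one_mul]
  | succ t ih =>
    rw [expect_stageLaw_succ, refLaw, expect_stageLaw_succ, ih]
    refine expect_congr fun ω _ => ?_
    rw [← expect_const_mul, expect_eq_expect_uniformDist]
    refine expect_congr fun i _ => ?_
    rw [← expect_const_mul, ← expect_const_mul, expect_eq_expect_uniformDist]
    refine expect_congr fun j _ => ?_
    rw [← expect_const_mul, ← expect_const_mul, ← expect_const_mul]
    refine expect_congr fun r _ => ?_
    simp only [likelihood]
    ring

lemma stagePayoff_eq_refLaw (G : Game K I J C D) (π : FinDist (K × S × T))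
    (σ : Strategy S I C) (τ : Strategy T J D) (t : ℕ) :
    stagePayoff G π σ τ t = expect (refLaw G π t) fun ω =>
      expect (uniformDist I) fun i => expect (uniformDist J) fun j =>
        nextLikelihood σ ω.2.1 i * nextLikelihood τ ω.2.2 j * G.g ω.1 i j := by
  rw [stagePayoff, expect_stageLaw_eq_refLaw]
  refine expect_congr fun ω _ => ?_
  rw [← expect_const_mul, expect_eq_expect_uniformDist]
  refine expect_congr fun i _ => ?_
  rw [← expect_const_mul, ← expect_const_mul, expect_eq_expect_uniformDist]
  refine expect_congr fun j _ => ?_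
  simp only [nextLikelihood]
  ring

lemma stagePayoff_mixture_left (G : Game K I J C D) (π : FinDist (K × S × T))
    {σ σ' ρ : Strategy S I C} {p q : ℝ} (τ : Strategy T J D)
    (h : ∀ h a, nextLikelihood ρ h a = p * nextLikelihood σ h a + q * nextLikelihood σ' h a)
    (t : ℕ) :
    stagePayoff G π ρ τ t = p * stagePayoff G π σ τ t + q * stagePayoff G π σ' τ t := by
  simp only [stagePayoff_eq_refLaw, h, ← expect_const_mul, ← expect_add]
  refine expect_congr fun ω _ => expect_congr fun i _ => expect_congr fun j _ => ?_
  ring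

lemma stagePayoff_mixture_right (G : Game K I J C D) (π : FinDist (K × S × T))
    {τ τ' ρ : Strategy T J D} {p q : ℝ} (σ : Strategy S I C)
    (h : ∀ h a, nextLikelihood ρ h a = p * nextLikelihood τ h a + q * nextLikelihood τ' h a)
    (t : ℕ) :
    stagePayoff G π σ ρ t = p * stagePayoff G π σ τ t + q * stagePayoff G π σ τ' t := by
  simp only [stagePayoff_eq_refLaw, h, ← expect_const_mul, ← expect_add]
  refine expect_congr fun ω _ => expect_congr fun i _ => expect_congr fun j _ => ?_
  ring

lemma continuous_expect {α Y : Type*} [TopologicalSpace Y] (μ : FinDist α) {f : Y → α → ℝ}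
    (hf : ∀ a, Continuous fun y => f y a) : Continuous fun y => expect μ (f y) := by
  simp only [expect_eq]
  exact continuous_finsetSum _ fun a _ => continuous_const.mul (hf a)

lemma continuous_likelihood {Y : Type*} [TopologicalSpace Y] {σ : Y → Strategy S A O}
    (hσ : ∀ h a, Continuous fun y => (σ y h).weights a) (s : S) (l : List (A × O)) :
    Continuous fun y => likelihood (σ y) s l := by
  induction l with
  | nil => exact continuous_const
  | cons a l ih => exact (continuous_const.mul (hσ _ _)).mul ih

/-- The reference law has finite support, so only finitely many coordinates of the strategy enter,
polynomially. -/
lemma continuous_stagePayoff {Y : Type*} [TopologicalSpace Y] (G : Game K I J C D)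
    (π : FinDist (K × S × T)) (σ : Strategy S I C) {τ : Y → Strategy T J D}
    (hτ : ∀ h a, Continuous fun y => (τ y h).weights a) (t : ℕ) :
    Continuous fun y => stagePayoff G π σ (τ y) t := by
  simp only [stagePayoff_eq_refLaw]
  refine continuous_expect _ fun ω => continuous_expect _ fun i => continuous_expect _ fun j => ?_
  exact (continuous_const.mul ((continuous_const.mul (hτ _ _)).mul
    (continuous_likelihood hτ _ _))).mul continuous_const

/-- The strategy of player 2 that agrees with `τ₀` before stage `m + 1` and with `y` from then on. -/
def extendStrategy (τ₀ : Strategy T J D) (m : ℕ) (y : History T J D → stdSimplex ℝ J) :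
    Strategy T J D :=
  fun h => if h.2.length < m then τ₀ h else ofWeights (y h) (y h).2.1 (y h).2.2

omit [Nonempty J] in
lemma exists_extendStrategy {τ₀ τ : Strategy T J D} {m : ℕ}
    (h : ∀ h : History T J D, h.2.length < m → τ h = τ₀ h) : ∃ y, extendStrategy τ₀ m y = τ := by
  refine ⟨fun h => ⟨fun j => (τ h).weights j, fun j => StdSimplex.weights_nonneg j, ?_⟩, ?_⟩
  · rw [← (τ h).total, Finsupp.sum_fintype _ _ (by simp)]
  · funext h'
    by_cases hh : h'.2.length < m
    · rw [extendStrategy, if_pos hh, h h' hh]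
    · rw [extendStrategy, if_neg hh]
      ext j
      rfl

/-- If player 2 has, against each strategy of player 1, a continuation from stage `m + 1` on that
holds the payoff of a block of stages down to `v`, he has one that does so up to `ε` against all
strategies of player 1. -/
lemma exists_uniform_reply (G : Game K I J C D) (π : FinDist (K × S × T)) (τ₀ : Strategy T J D)
    (m n : ℕ) {v ε : ℝ} (hε : 0 < ε)
    (h : ∀ σ : Strategy S I C, ∃ τ : Strategy T J D,
      (∀ h : History T J D, h.2.length < m → τ h = τ₀ h) ∧
        ∑ u ∈ Finset.range n, stagePayoff G π σ τ (m + u) ≤ v) :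
    ∃ τ : Strategy T J D, (∀ h : History T J D, h.2.length < m → τ h = τ₀ h) ∧
      ∀ σ : Strategy S I C, ∑ u ∈ Finset.range n, stagePayoff G π σ τ (m + u) ≤ v + ε := by
  -- By Tychonoff the space of continuations, a product of simplices over all histories, is compact.
  have : CompactSpace (stdSimplex ℝ J) := isCompact_iff_compactSpace.1 (isCompact_stdSimplex ℝ J)
  have hext : ∀ y (h : History T J D), h.2.length < m → extendStrategy τ₀ m y h = τ₀ h :=
    fun y h hh => if_pos hh
  obtain ⟨y₀, -⟩ := exists_extendStrategy (τ₀ := τ₀) (τ := τ₀) (m := m) fun _ _ => rfl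
  have : Nonempty (History T J D → stdSimplex ℝ J) := ⟨y₀⟩
  obtain ⟨y, hy⟩ := exists_forall_le_of_forall_exists_le
    (γ := fun (σ : Strategy S I C) (y : History T J D → stdSimplex ℝ J) =>
      ∑ u ∈ Finset.range n, stagePayoff G π σ (extendStrategy τ₀ m y) (m + u))
    (fun σ => continuous_finsetSum _ fun u _ => continuous_stagePayoff G π σ (fun h j => by
      by_cases hh : h.2.length < m
      · simp only [extendStrategy, hh, if_true]
        exact continuous_const
      · simp only [extendStrategy, hh, if_false, ofWeights_weights]
        exact (continuous_apply j).comp (continuous_subtype_val.comp (continuous_apply h))) _)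
    (fun σ σ' p q hp hq hpq => by
      obtain ⟨ρ, -, hρ⟩ := exists_mixture σ σ' hp hq hpq
      refine ⟨ρ, fun y => ?_⟩
      simp only [stagePayoff_mixture_left G π _ hρ, Finset.sum_add_distrib, Finset.mul_sum])
    (fun y y' p q hp hq hpq => by
      obtain ⟨ρ, hρ', hρ⟩ := exists_mixture (extendStrategy τ₀ m y) (extendStrategy τ₀ m y')
        hp hq hpq
      obtain ⟨y'', rfl⟩ := exists_extendStrategy (τ₀ := τ₀) (τ := ρ) (m := m) fun h hh => by
        rw [hρ' h (by rw [hext y h hh, hext y' h hh]), hext y h hh]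
      refine ⟨y'', fun σ => ?_⟩
      simp only [stagePayoff_mixture_right G π _ hρ, Finset.sum_add_distrib, Finset.mul_sum])
    hε (fun σ => by
      obtain ⟨τ, hτ, hle⟩ := h σ
      obtain ⟨y, rfl⟩ := exists_extendStrategy hτ
      exact ⟨y, hle⟩)
  exact ⟨extendStrategy τ₀ m y, hext y, hy⟩

end Likelihood

/-! ### Player 2 guarantees `v*` -/

section Player2

variable {G : Game K I J C D} {π : FinDist (K × S × T)}

lemma value_le_one [Nonempty I] [Nonempty J] (G : Game K I J C D) (π : FinDist (K × S × T))
    (m n : ℕ) : value G π m n ≤ 1 := by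
  have : Nonempty (Strategy S I C) := ⟨fun _ => StdSimplex.single (Classical.arbitrary I)⟩
  have τ₀ : Strategy T J D := fun _ => StdSimplex.single (Classical.arbitrary J)
  refine ciSup_le fun σ => (ciInf_le ⟨0, ?_⟩ τ₀).trans (avgPayoff_mem_Icc G π σ _ m n).2
  rintro _ ⟨τ, rfl⟩
  exact (avgPayoff_mem_Icc G π σ τ m n).1

lemma value_nonneg [Nonempty I] [Nonempty J] (G : Game K I J C D) (π : FinDist (K × S × T))
    (m n : ℕ) : 0 ≤ value G π m n :=
  Real.iSup_nonneg fun σ => Real.iInf_nonneg fun τ => (avgPayoff_mem_Icc G π σ τ m n).1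

/-- If player 2 can hold the payoff of each block of `n` stages down to `n * w`, whatever he does
before the block, he can do so in all blocks simultaneously. -/
lemma exists_block_strategy {w : ℝ} {n : ℕ} (hn : 0 < n) (τ₀ : Strategy T J D)
    (h : ∀ (m : ℕ) (τ₀ : Strategy T J D), ∃ τ : Strategy T J D,
      (∀ h : History T J D, h.2.length < m → τ h = τ₀ h) ∧
        ∀ σ : Strategy S I C, ∑ u ∈ Finset.range n, stagePayoff G π σ τ (m + u) ≤ n * w) :
    ∃ τ : Strategy T J D, ∀ (σ : Strategy S I C) (l : ℕ),
      ∑ u ∈ Finset.range n, stagePayoff G π σ τ (l * n + u) ≤ n * w := by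
  choose next hnext1 hnext2 using h
  -- `U l` is final on the first `l` blocks, since each later continuation leaves the earlier stages
  -- untouched.
  let U : ℕ → Strategy T J D := fun l => Nat.rec τ₀ (fun l τ => next (l * n) τ) l
  have hU : ∀ l, U (l + 1) = next (l * n) (U l) := fun _ => rfl
  have hstable : ∀ (h : History T J D) l, h.2.length / n + 1 ≤ l →
      U l h = U (h.2.length / n + 1) h := by
    intro h l hl
    induction l, hl using Nat.le_induction with
    | base => rfl
    | succ l hl ih =>
      rw [hU, hnext1 _ _ h, ih]
      calc h.2.length < (h.2.length / n + 1) * n := by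
            rw [add_mul, one_mul]; exact Nat.lt_div_mul_add hn
        _ ≤ l * n := Nat.mul_le_mul_right n hl
  refine ⟨fun h => U (h.2.length / n + 1) h, fun σ l => ?_⟩
  refine le_trans (le_of_eq (Finset.sum_congr rfl fun u hu => ?_)) (hnext2 (l * n) (U l) σ)
  refine stagePayoff_congr fun h hh => ?_
  rw [← hU]
  refine (hstable h (l + 1) (Nat.succ_le_succ ?_)).symm
  rw [← Nat.lt_succ_iff, Nat.div_lt_iff_lt_mul hn, Nat.succ_mul]
  have := Finset.mem_range.1 hu
  omega

/-- Round `N` up to full blocks: by nonnegativity this only increases the sum, and it adds at most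
`n` stages. -/
lemma sum_range_le_of_blocks {p : ℕ → ℝ} (hp : ∀ t, 0 ≤ p t) {n : ℕ} (hn : 0 < n) {w : ℝ}
    (h : ∀ l, ∑ u ∈ Finset.range n, p (l * n + u) ≤ n * w) (N : ℕ) :
    ∑ t ∈ Finset.range N, p t ≤ (N + n) * w := by
  have hn' : (0 : ℝ) < n := Nat.cast_pos.2 hn
  have hw : 0 ≤ w := by
    have : 0 ≤ n * w := (Finset.sum_nonneg fun u _ => hp _).trans (h 0)
    exact nonneg_of_mul_nonneg_right this hn'
  have h1 : ∀ q : ℕ, ∑ t ∈ Finset.range (q * n), p t ≤ q * n * w := by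
    intro q
    induction q with
    | zero => simp
    | succ q ih =>
      rw [Nat.succ_mul, Finset.sum_range_add]
      push_cast
      linarith [h q]
  have h2 : N ≤ (N / n + 1) * n := by
    rw [add_mul, one_mul]; exact (Nat.lt_div_mul_add hn).le
  calc ∑ t ∈ Finset.range N, p t ≤ ∑ t ∈ Finset.range ((N / n + 1) * n), p t :=
        Finset.sum_le_sum_of_subset_of_nonneg (Finset.range_subset_range.2 h2) fun t _ _ => hp t
    _ ≤ ((N / n + 1 : ℕ) : ℝ) * n * w := h1 _
    _ ≤ (N + n) * w := by
        refine mul_le_mul_of_nonneg_right ?_ hw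
        have : ((N / n * n : ℕ) : ℝ) ≤ N := Nat.cast_le.2 (Nat.div_mul_le_self N n)
        push_cast at this ⊢
        linarith

theorem player2CanGuarantee_vStar [Finite K] [Finite I] [Finite J] [Nonempty I] [Nonempty J]
    {G : Game K I J C D} (hA1 : A1 G) (hA2b : A2b G) (hA3 : A3 G) {π : FinDist (K × ℕ × ℕ)}
    (hπ : π ∈ DeltaStar K) : Player2CanGuarantee G π (vStar G π) := by
  have := Fintype.ofFinite I
  have := Fintype.ofFinite J
  obtain ⟨F, hF⟩ := exists_isUpdate hA1
  obtain ⟨f, hf⟩ := exists_belief2_auxQ_eq hF hA2b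
  obtain ⟨y₀, hy⟩ := hπ.2
  have hx := isInitialBelief_of_A1a hπ.1
  intro ε hε
  -- The error is split in three: choice of `n`, minimax slack in each block, and the incomplete
  -- last block.
  obtain ⟨n, hn⟩ := exists_lt_of_ciInf_lt
    (show vStar G π < vStar G π + ε / 3 by linarith)
  set v : ℝ := ⨆ m : ℕ, value G π m n with hv
  have hvle : ∀ m, value G π m n ≤ v := fun m =>
    le_ciSup (f := fun m => value G π m n) ⟨1, by
      rintro _ ⟨m, rfl⟩; exact value_le_one G π m n⟩ m
  have hv0 : 0 ≤ v := (value_nonneg G π 0 n).trans (hvle 0)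
  have hn' : (0 : ℝ) < (n : ℕ) := Nat.cast_pos.2 n.pos
  obtain ⟨τ, hτ⟩ := exists_block_strategy (G := G) (π := π) (I := I) (C := C) (w := v + ε / 3)
    n.pos (fun _ => uniformDist J) fun m τ₀ => by
      rw [mul_add]
      refine exists_uniform_reply G π τ₀ m n (by positivity) fun σ => ?_
      obtain ⟨τ, h1, h2⟩ := exists_reply_sum_le_dp hF hA3 hx (uniformDist J) σ τ₀ m n
      refine ⟨τ, h1, h2.trans ((expect_dp_le_value hF hA3 hf hx hy _ m n n.pos).trans ?_)⟩
      exact mul_le_mul_of_nonneg_left (hvle m) hn'.le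
  -- For `M ≥ N` the excess `n * (v + ε / 3)` of the last block is at most `M * ε / 3`.
  obtain ⟨N, hN⟩ := exists_nat_ge (3 * (n : ℕ) * (v + ε / 3) / ε)
  refine ⟨τ, N + 1, fun M hM σ => ?_⟩
  have hM0 : (0 : ℝ) < M := Nat.cast_pos.2 (by omega)
  have hMN : (N : ℝ) ≤ M := Nat.cast_le.2 (by omega)
  have h1 := sum_range_le_of_blocks (fun t => (stagePayoff_mem_Icc G π σ τ t).1) n.pos (hτ σ) M
  rw [avgPayoff, div_le_iff₀ hM0]
  simp only [zero_add]
  have h2 : 3 * (n : ℕ) * (v + ε / 3) ≤ M * ε := (div_le_iff₀ hε).1 (hN.trans hMN)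
  have h3 : M * v ≤ M * (vStar G π + ε / 3) := mul_le_mul_of_nonneg_left hn.le hM0.le
  linarith

end Player2

/-! ### Markov strategies -/

section Markov

/-- The law of the state of the auxiliary game at stage `t + 1` when player 1 uses the Markov
strategy `ψ`. The action `b` of player 2 is immaterial. -/
def markovLaw (G : Game K I J C D) (b : FinDist J) (z : Belief2 K)
    (ψ : ℕ → Belief2 K → AuxAct1 K I) : ℕ → FinDist (Belief2 K)
  | 0 => StdSimplex.single z
  | t + 1 => mix (markovLaw G b z ψ t) fun z' => auxTransition G z' (ψ t z') b

variable {G : Game K I J C D} {F : FinDist K → I → C → FinDist K} {z : Belief2 K}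
  {ψ : ℕ → Belief2 K → AuxAct1 K I}

lemma expect_canonical_single (z : Belief2 K)
    (f : K × (FinDist K × Belief2 K) × Belief2 K → ℝ) :
    expect (canonical (StdSimplex.single z)) f =
      expect z fun p => expect p fun k => f (k, (p, z), z) := by
  simp only [canonical, expect_mix, expect_map, expect_single]

lemma isInitialBelief_canonical (z : Belief2 K) :
    IsInitialBelief (canonical (StdSimplex.single z)) fun c => c.1 := by
  intro Ψ
  rw [expect_canonical_single, expect_canonical_single]
  simp only [expect_const]

lemma belief2_canonical (z : Belief2 K) {ω} (hω : ω ∈ supp (canonical (StdSimplex.single z))) :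
    belief2 (canonical (StdSimplex.single z)) ω.2.2 = z :=
  belief2_eq_of_isCond (isInitialBelief_canonical z) (κ := fun _ => z) (fun Ψ => by
    rw [expect_canonical_single, expect_canonical_single]
    simp only [expect_const]) hω

lemma length_of_mem_supp_auxLaw {s : AuxStrategy1 K I J} {r : AuxStrategy2 K I J} {t : ℕ} {h}
    (hh : h ∈ supp (auxLaw G z s r t)) : h.1.length = t := by
  induction t generalizing h with
  | zero =>
    rw [auxLaw, supp_single] at hh
    rw [hh]
    rfl
  | succ t ih =>
    simp only [auxLaw, supp_mix, supp_map] at hh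
    obtain ⟨h', hh', z', -, rfl⟩ := hh
    simp [ih hh']

lemma expect_auxLaw_markov (hF : IsUpdate G F) (hA3 : A3 G) (b : FinDist J)
    (r : AuxStrategy2 K I J) (t : ℕ) (φ : Belief2 K → ℝ) :
    expect (auxLaw G z (markovStrategy ψ) r t) (fun h => φ h.2) =
      expect (markovLaw G b z ψ t) φ := by
  induction t generalizing φ with
  | zero => simp only [auxLaw, markovLaw, expect_single]
  | succ t ih =>
    simp only [auxLaw, markovLaw, expect_mix, expect_map]
    rw [← ih]
    refine expect_congr fun h hh => ?_
    rw [auxTransition_eq hF hA3 _ _ _ b, markovStrategy, length_of_mem_supp_auxLaw hh]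

lemma expect_stageLaw_markov (hF : IsUpdate G F) (hA3 : A3 G) (b : FinDist J)
    {σ : Strategy (FinDist K × Belief2 K) I C} (hσ : InducedBy G z ψ σ)
    (τ : Strategy (Belief2 K) J D) (t : ℕ) (φ : Belief2 K → ℝ) :
    expect (stageLaw G (canonical (StdSimplex.single z)) σ τ t)
        (fun ω => φ (belief2 (stageLaw G (canonical (StdSimplex.single z)) σ τ t) ω.2.2)) =
      expect (markovLaw G b z ψ t) φ := by
  have hx := isInitialBelief_canonical z
  induction t generalizing φ with
  | zero =>
    rw [expect_belief2_zero hF hx, markovLaw, expect_single,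
      expect_congr fun ω hω => by rw [belief2_canonical z hω], expect_const]
  | succ t ih =>
    rw [expect_belief2_stageLaw_succ hF hx (isSeenAs_markov hF hx (hσ τ t)), markovLaw,
      expect_mix, ← ih]
    exact expect_congr fun ω _ => by rw [auxTransition_eq hF hA3 _ _ _ b]

variable [Finite J] [Nonempty J]

/-- The average payoff over the first `n` stages of the Markov strategy `ψ` in the auxiliary game
against a best reply. -/
def markovPayoff (G : Game K I J C D) (b : FinDist J) (z : Belief2 K)
    (ψ : ℕ → Belief2 K → AuxAct1 K I) (n : ℕ) : ℝ :=
  (∑ t ∈ Finset.range n, expect (markovLaw G b z ψ t) fun z' => gMin G z' (ψ t z')) / n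

/-- The state law is the same against every reply, so `gMin` bounds each stage from below, and one
strategy of player 2 attains all these bounds together. -/
lemma auxGuarantees_iff (hF : IsUpdate G F) (hA3 : A3 G) (b : FinDist J) (w : ℝ) :
    AuxGuarantees G z (markovStrategy ψ) w ↔ ∃ N, ∀ n ≥ N, w ≤ markovPayoff G b z ψ n := by
  have hlaw : ∀ (r : AuxStrategy2 K I J) t, expect (auxLaw G z (markovStrategy ψ) r t)
      (fun h => gMin G h.2 (markovStrategy ψ h)) =
        expect (markovLaw G b z ψ t) fun z' => gMin G z' (ψ t z') := by
    intro r t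
    rw [← expect_auxLaw_markov hF hA3 b r t]
    exact expect_congr fun h hh => by rw [markovStrategy, length_of_mem_supp_auxLaw hh]
  constructor
  · rintro ⟨N, hN⟩
    refine ⟨N, fun n hn => ?_⟩
    have h := hN n hn fun h => (exists_auxG_eq_gMin G h.2 (markovStrategy ψ h)).choose
    refine h.trans_eq ?_
    rw [auxAvgPayoff, markovPayoff]
    congr 1
    refine Finset.sum_congr rfl fun t _ => ?_
    rw [← hlaw]
    exact expect_congr fun h _ =>
      (exists_auxG_eq_gMin G h.2 (markovStrategy ψ h)).choose_spec
  · rintro ⟨N, hN⟩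
    refine ⟨N, fun n hn r => (hN n hn).trans ?_⟩
    refine div_le_div_of_nonneg_right (Finset.sum_le_sum fun t _ => ?_) (Nat.cast_nonneg n)
    rw [← hlaw r]
    exact expect_mono fun h _ => gMin_le_auxG G _ _ _

/-- As in the auxiliary game, but the best reply is built recursively: player 2 needs `y_t`, which
depends on the law generated by his own earlier behavior. -/
lemma guarantees_iff (hF : IsUpdate G F) (hA3 : A3 G) (b : FinDist J)
    {σ : Strategy (FinDist K × Belief2 K) I C} (hσ : InducedBy G z ψ σ) (w : ℝ) :
    Guarantees G (canonical (StdSimplex.single z)) σ w ↔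
      ∃ N, ∀ n ≥ N, w ≤ markovPayoff G b z ψ n := by
  have hx := isInitialBelief_canonical z
  have hA := fun τ t => isSeenAs_markov (ψ := ψ) hF hx (hσ τ t)
  constructor
  · rintro ⟨N, hN⟩
    refine ⟨N, fun n hn => ?_⟩
    obtain ⟨τ, -, hτ⟩ := exists_bestReply G (canonical (StdSimplex.single z)) σ (fun _ => b) 0
      fun t μ h => ψ t (belief2 μ h)
    refine (hN n hn τ).trans_eq ?_
    rw [avgPayoff, markovPayoff]
    congr 1
    refine Finset.sum_congr rfl fun t _ => ?_
    rw [zero_add, stagePayoff_eq_auxG hF hx (hA τ t), ← expect_stageLaw_markov hF hA3 b hσ τ t]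
    exact expect_congr (hτ t (Nat.zero_le t))
  · rintro ⟨N, hN⟩
    refine ⟨N, fun n hn τ => (hN n hn).trans ?_⟩
    refine div_le_div_of_nonneg_right (Finset.sum_le_sum fun t _ => ?_) (Nat.cast_nonneg n)
    rw [zero_add, stagePayoff_eq_auxG hF hx (hA τ t), ← expect_stageLaw_markov hF hA3 b hσ τ t]
    exact expect_mono fun ω _ => gMin_le_auxG G _ _ _

end Markov

end RepGame

end

open RepGame
theorem mainTheorem7 {K I J C D : Type*} [Finite K] [Finite I] [Finite J] [Finite C] [Finite D]
    [Nonempty I] [Nonempty J] (G : Game K I J C D) (hA1 : A1 G) (hA2b : A2b G) (hA3 : A3 G) :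
    (∀ (z : Belief2 K) (ψ : ℕ → Belief2 K → AuxAct1 K I),
      (∃ σ : Strategy (FinDist K × Belief2 K) I C, InducedBy G z ψ σ) ∧
      ∀ σ : Strategy (FinDist K × Belief2 K) I C, InducedBy G z ψ σ →
        ∀ w : ℝ, AuxGuarantees G z (markovStrategy ψ) w ↔
          Guarantees G (canonical (StdSimplex.single z)) σ w) ∧
    (∀ π ∈ DeltaStar K, Player2CanGuarantee G π (vStar G π)) := by
  obtain ⟨F, hF⟩ := exists_isUpdate hA1
  obtain ⟨f, hf⟩ := exists_belief2_auxQ_eq hF hA2b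
  refine ⟨fun z ψ => ⟨⟨_, inducedStrategy_spec hF hf (isInitialBelief_canonical z)
      (y₀ := fun _ => z) (fun ω hω => belief2_canonical z hω) ψ⟩, fun σ hσ w => ?_⟩,
    fun π hπ => player2CanGuarantee_vStar hA1 hA2b hA3 hπ⟩
  let b : FinDist J := StdSimplex.single (Classical.arbitrary J)
  rw [auxGuarantees_iff hF hA3 b, guarantees_iff hF hA3 b hσ]
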